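/- Let $n,k,d$ be integers with $2\le n$, $1\le k\le n$ and $1\le d\le n-1$. A storage network has $n$ nodes, which fail one at a time. A (dynamic) helper selection scheme $A$ chooses, for every finite history of past failures and every node $j$ that fails next, a set of $d$ nodes other than $j$, the helpers of the newcomer that replaces $j$. Let $\alpha,\beta\ge 0$ be real. Every finite failure pattern determines an information flow graph $G$ of $A$: there are a source $s$, and vertices $x_{\mathrm{in}},x_{\mathrm{out}}$ joined by an edge $x_{\mathrm{in}}\to x_{\mathrm{out}}$ of capacity $\alpha$ for each of the $n$ initial storage nodes and each newcomer $x$; $s$ has an edge of infinite capacity to $x_{\mathrm{in}}$ for each initial node $x$; each newcomer $y$ receives an edge $x_{\mathrm{out}}\to y_{\mathrm{in}}$ of capacity $\beta$ from each of its $d$ helpers $x$ (the storage nodes then active); and for each set of $k$ of the $n$ finally active storage nodes there is a data collector $t$ that receives an edge of infinite capacity from $x_{\mathrm{out}}$ for each $x$ in that set. Write $\mathcal G_A=\mathcal G_A(n,k,d,\alpha,\beta)$ for the collection of these graphs, $\mathrm{DC}(G)$ for the set of data collectors of $G$, and $\mathrm{mincut}_G(s,t)$ for the minimum value of a cut separating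 $s$ from $t$. Consider the conditions (i) $d=1$, $k=3$ and $n$ is odd; (ii) $k\le\left\lceil \frac{n}{n-d}\right\rceil$. If at least one of (i) and (ii) holds, then for every helper selection scheme $A$ and all $(\alpha,\beta)$ $$\min_{G\in\mathcal G_A}\ \min_{t\in \mathrm{DC}(G)}\mathrm{mincut}_G(s,t)=\sum_{i=0}^{k-1}\min\bigl((d-i)^+\beta,\alpha\bigr),\qquad (x)^+=\max(x,0).$$ Conversely, if neither (i) nor (ii) holds, then there are a helper selection scheme $A$ and a pair $(\alpha,\beta)$ of nonnegative integers such that $$\min_{G\in\mathcal G_A}\ \min_{t\in \mathrm{DC}(G)}\mathrm{mincut}_G(s,t)>\sum_{i=0}^{k-1}\min\bigl((d-i)^+\beta,\alpha\bigr)$$ and, moreover, for this same $A$ and $(\alpha,\beta)$ and every file size $\mathcal M\in\{0,1,2,\dots\}$ with $\mathcal M\le\min_{G\in\mathcal G_A}\min_{t\in \mathrm{DC}(G)}\mathrm{mincut}_G(s,t)$, there exist a finite field $\mathrm{GF}(q)$ and a linear regenerating code over $\mathrm{GF}(q)$ with helper selection scheme $A$ that meets the reliability requirement. Here a packet is an element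 of $\mathrm{GF}(q)$; the file consists of $\mathcal M$ packets and each node stores $\alpha$ packets; the code consists of linear maps that give the initial contents of the nodes from the file and, for each history and each failing node, the $\beta$ packets that each helper sends (computed from its contents) and the $\alpha$ packets that the newcomer stores (computed from the $d\beta$ packets received). The reliability requirement says that after every finite failure pattern the file can be reconstructed from the contents of any $k$ of the $n$ nodes. -/

import Mathlib

open scoped NNReal ENNReal

/-- A (dynamic) helper selection scheme for `n` nodes and `d` helpers. If the nodes `h` have failed
so far (one at a time, in chronological order) and node `j` fails next, then the newcomer replacing
`j` accesses the set `helpers h j` of `d` surviving nodes. Since the scheme is deterministic, the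
past helper choices are functions of the past failures, so they need not be a further argument. -/
structure HelperScheme (n d : ℕ) where
  helpers : List (Fin n) → Fin n → Finset (Fin n)
  card_helpers : ∀ h j, (helpers h j).card = d
  not_mem_helpers : ∀ h j, j ∉ helpers h j

/-- The storage nodes of an information flow graph after `T` failures: the `n` initial nodes and the
`T` newcomers, where the newcomer `s` is the one created by the `s`-th failure (from `0`). -/
abbrev StorageNode (n T : ℕ) := Fin n ⊕ Fin T

/-- The vertices of an information flow graph after `T` failures: the source, an input vertex and an
output vertex for every storage node (active or not), and one data collector for every set of `k` of
the `n` (currently active) nodes. -/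
inductive IFGVertex (n k T : ℕ) where
  | source : IFGVertex n k T
  | inp : StorageNode n T → IFGVertex n k T
  | out : StorageNode n T → IFGVertex n k T
  | collector : {D : Finset (Fin n) // D.card = k} → IFGVertex n k T
  deriving Fintype

/-- For the chronological failure pattern `h`, the storage node that plays the role of node `i`
after the first `s` failures (that is, the active one). -/
def activeNode {n : ℕ} (h : List (Fin n)) : ℕ → Fin n → StorageNode n h.length
  | 0, i => Sum.inl i
  | s + 1, i =>
    if hs : s < h.length then
      if h[s] = i then Sum.inr ⟨s, hs⟩ else activeNode h s i
    else activeNode h s i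

/-- The information flow graph that the scheme `A` produces for the failure pattern `h`, given by the
capacities of its edges; capacity `0` means that there is no edge.
* The source is connected to the input of each initial node by an edge of infinite capacity.
* Input and output of the same storage node are connected by an edge of capacity `α`.
* The outputs of the `d` helpers (the storage nodes active just before the failure `s`) are connected
  to the input of the newcomer `s` by edges of capacity `β`.
* Each data collector is connected to `k` storage nodes active at the end by edges of infinite
  capacity. -/
noncomputable def ifgCapacity {n d : ℕ} (A : HelperScheme n d) (k : ℕ) (α β : ℝ≥0)
    (h : List (Fin n)) : IFGVertex n k h.length → IFGVertex n k h.length → ℝ≥0∞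
  | .source, .inp (.inl _) => ⊤
  | .inp x, .out y => if x = y then (α : ℝ≥0∞) else 0
  | .out x, .inp (.inr s) =>
    if ∃ i ∈ A.helpers (h.take s) h[s], x = activeNode h s i then (β : ℝ≥0∞) else 0
  | .out x, .collector D => if ∃ i ∈ D.1, x = activeNode h h.length i then ⊤ else 0
  | _, _ => 0

open Classical in
/-- The minimum value of a cut separating `s` from `t` in the directed graph on the vertices `V` with
the edge capacities `c`. -/
noncomputable def minCut {V : Type*} [Fintype V] (c : V → V → ℝ≥0∞) (s t : V) : ℝ≥0∞ :=
  ⨅ (S : Set V) (_ : s ∈ S) (_ : t ∉ S), ∑ u, ∑ v, if u ∈ S ∧ v ∉ S then c u v else 0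

/-- The set of all values `mincut_G(s, t)`, where `G` runs over all information flow graphs of the
scheme `A` (one for each finite failure pattern) and `t` over the data collectors of `G`. -/
def minCutValues {n d : ℕ} (A : HelperScheme n d) (k : ℕ) (α β : ℝ≥0) : Set ℝ≥0∞ :=
  {c | ∃ (h : List (Fin n)) (D : {D : Finset (Fin n) // D.card = k}),
    c = minCut (ifgCapacity A k α β h) .source (.collector D)}

/-- The blind-repair value `∑_{i < k} min ((d - i)⁺ β, α)`; the subtraction of natural numbers is
the truncated one, that is, `(d - i)⁺`. -/
noncomputable def blindRepairValue (k d : ℕ) (α β : ℝ≥0) : ℝ≥0∞ :=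
  ∑ i ∈ Finset.range k, min (((d - i : ℕ) : ℝ≥0∞) * β) α

/-- A (functional-repair, linear) regenerating code over the field `F` for the helper selection
scheme `A`: the file consists of `M` packets, each node stores `α` packets and each helper sends `β`
packets, where a packet is an element of `F`. -/
structure RegeneratingCode (F : Type) [Field F] {n d : ℕ} (A : HelperScheme n d) (M α β : ℕ) where
  /-- The initial contents of the nodes. -/
  encode : Fin n → (Fin M → F) →ₗ[F] (Fin α → F)
  /-- What the node `x` computes from its contents and sends to the newcomer replacing `j`, when `j`
  fails after the failures `h`. -/
  send : (h : List (Fin n)) → (j x : Fin n) → (Fin α → F) →ₗ[F] (Fin β → F)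
  /-- What the newcomer replacing `j` stores, given what its helpers have sent. -/
  restore : (h : List (Fin n)) → (j : Fin n) →
    ({x // x ∈ A.helpers h j} → Fin β → F) →ₗ[F] (Fin α → F)

/-- The contents of node `i` after the first `s` failures of the chronological failure pattern `h`,
when the file is `w`. -/
def RegeneratingCode.content {F : Type} [Field F] {n d : ℕ} {A : HelperScheme n d} {M α β : ℕ}
    (C : RegeneratingCode F A M α β) (w : Fin M → F) (h : List (Fin n)) : ℕ → Fin n → Fin α → F
  | 0, i => C.encode i w
  | s + 1, i =>
    if hs : s < h.length then
      if h[s] = i then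
        C.restore (h.take s) h[s] fun x => C.send (h.take s) h[s] x (C.content w h s x)
      else C.content w h s i
    else C.content w h s i

/-- The reliability requirement: after any failure pattern, the file can be reconstructed from the
contents of any `k` nodes. -/
def RegeneratingCode.Reliable {F : Type} [Field F] {n d : ℕ} {A : HelperScheme n d} {M α β : ℕ}
    (C : RegeneratingCode F A M α β) (k : ℕ) : Prop :=
  ∀ (h : List (Fin n)) (D : Finset (Fin n)), D.card = k →
    ∃ decode : ({x // x ∈ D} → Fin α → F) → (Fin M → F),
      ∀ w : Fin M → F, decode (fun x => C.content w h h.length x) = w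

/-!
An information flow graph has a cut of finite value for every set `X` of storage nodes whose outputs
are on the side of the collector, and every set `Y` of newcomers whose inputs are there
(`cutCost`, `exists_minCut_eq_cutCost`). If the elements of `X` are ordered by birth, then the one of
rank `i` has at most `i` helpers in `X`, so that it costs at least `min ((d - i)⁺ β, α)`. This gives
the value of blind repair as a lower bound for every scheme (`blindRepairValue_le_minCut`).

The bound is attained in the two exceptional cases. If `(k - 1) (n - d) < n`, let every node fail
once; a greedy choice from the last newcomer backwards finds `k` newcomers each of which is helped by
all older ones (`exists_clique`). If `d = 1`, `k = 3` and `n` is odd, let every node fail once, and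
then repeatedly a node that is not related to any other node; by parity, three nodes
eventually descend from the same newcomer (`exists_three_labels`).

In all other cases take `α = d` and `β = 1`. If a cut costs no more than under blind repair, then all
the bounds above are tight: each of the first `d + 1` elements of `X` is helped by all older ones,
and each element but the oldest has a helper in `X`. For `d ≥ 2`, split the nodes into
blocks of at most `n - d` nodes and let no node be helped from its own block: the first `d + 1`
elements of `X` would lie in distinct blocks, but there are fewer than `min k (d + 1)` blocks
(`lt_cutCost_of_parts`). For `d = 1`, split the nodes into pairs, and one triple if `n` is odd, and
let every node be helped from its own component: `X` would lie in a single component, but it contains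
`k` active nodes (`lt_cutCost_of_components`).

For any scheme, codes over a single finite field reach the minimum `M` of all cuts. The demand of a
collector for `M` packets is traced back in time: undoing a failure distributes the demand on the
newcomer over its helpers. This succeeds because the cut function is submodular
(`exists_raise_of_submodular`, `exists_routable`). In the forward direction, the code keeps the
following property: for every future, some demand on the present nodes to which the demand of the
collector can be traced back is served, that is, the corresponding packets are linearly independent.
A repair with suitable coefficients preserves the property for one such demand
(`exists_newContent_serves`). There are only finitely many vectors of demands, each giving a
nonvanishing polynomial of bounded degree in the coefficients, so over a large field one choice of
coefficients works for all of them (`exists_newContent_serves_all`), however long the history is.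
-/

/-! ### Repairs with generic coefficients -/

section Algebra

/-- Finitely many nonzero polynomials of bounded degree have a common non-root over a field that is
large compared with their number and their degree. -/
theorem exists_common_nonroot {F σ ι : Type*} [Field F] [Fintype F] [Finite σ] (s : Finset ι)
    (P : ι → MvPolynomial σ F) (N : ℕ) (hP : ∀ i ∈ s, P i ≠ 0)
    (hdeg : ∀ i ∈ s, (P i).totalDegree ≤ N) (hF : s.card * N < Fintype.card F) :
    ∃ v : σ → F, ∀ i ∈ s, MvPolynomial.eval v (P i) ≠ 0 := by
  by_contra! hcon
  have hne : ∏ i ∈ s, P i ≠ 0 := Finset.prod_ne_zero_iff.2 hP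
  refine hne (MvPolynomial.eq_zero_of_eval_zero_at_prod_finset _ (fun _ => Finset.univ) ?_ ?_)
  · intro j
    refine lt_of_le_of_lt (MvPolynomial.degreeOf_le_totalDegree _ _) (lt_of_le_of_lt ?_ hF)
    refine (MvPolynomial.totalDegree_finsetProd _ _).trans ?_
    simpa using Finset.sum_le_card_nsmul s _ N hdeg
  · intro v _
    obtain ⟨i, hi, h0⟩ := hcon v
    rw [map_prod]
    exact Finset.prod_eq_zero hi h0

theorem totalDegree_det_le {R σ m : Type*} [CommRing R] [Fintype m] [DecidableEq m]
    (Q : Matrix m m (MvPolynomial σ R)) (N : ℕ) (hQ : ∀ i j, (Q i j).totalDegree ≤ N) :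
    Q.det.totalDegree ≤ Fintype.card m * N := by
  rw [Matrix.det_apply]
  refine MvPolynomial.totalDegree_finsetSum_le fun τ _ => ?_
  refine (MvPolynomial.totalDegree_smul_le _ _).trans ?_
  refine (MvPolynomial.totalDegree_finsetProd _ _).trans ?_
  simpa using Finset.sum_le_card_nsmul Finset.univ _ N fun i _ => hQ (τ i) i

variable {F : Type*} [Field F] {n α β M : ℕ}

/-- The stored packets are described by their coefficient vectors: `W i t` expresses the packet `t`
of node `i` in terms of the `M` packets of the file. The demand `a` is *served* by the contents `W`
if the first `a i` packets of the nodes `i` are, together, linearly independent. -/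
def Serves (W : Fin n → Fin α → Fin M → F) (a : Fin n → ℕ) : Prop :=
  LinearIndependent F fun p : {p : Fin n × Fin α // (p.2 : ℕ) < a p.1} => W p.1.1 p.1.2

/-- The contents of a newcomer: its packet `t` is the combination with coefficients `ρ t i s` of the
packets `s` of the helpers `i ∈ H`, which in turn are combinations, with coefficients `σ i s u`, of
the packets `u` of node `i`. -/
def newContent (W : Fin n → Fin α → Fin M → F) (H : Finset (Fin n))
    (σ : Fin n → Fin β → Fin α → F) (ρ : Fin α → Fin n → Fin β → F) (t : Fin α) : Fin M → F :=
  ∑ i ∈ H, ∑ s, ρ t i s • ∑ u, σ i s u • W i u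

theorem card_demand (a : Fin n → ℕ) (ha : ∀ i, a i ≤ α) :
    Fintype.card {p : Fin n × Fin α // (p.2 : ℕ) < a p.1} = ∑ i, a i := by
  have e : {p : Fin n × Fin α // (p.2 : ℕ) < a p.1} ≃ Σ i, Fin (a i) :=
    { toFun := fun p => ⟨p.1.1, p.1.2, p.2⟩
      invFun := fun q => ⟨(q.1, ⟨q.2, q.2.2.trans_le (ha q.1)⟩), q.2.2⟩
      left_inv := fun p => rfl
      right_inv := fun q => rfl }
  rw [Fintype.card_congr e]
  simp

/-- A demand of `M` packets is served if and only if the square matrix of the corresponding rows is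
nonsingular. -/
theorem serves_iff_det_ne_zero {a : Fin n → ℕ}
    (e : Fin M ≃ {p : Fin n × Fin α // (p.2 : ℕ) < a p.1}) (W : Fin n → Fin α → Fin M → F) :
    Serves W a ↔ (Matrix.of fun m => W (e m).1.1 (e m).1.2).det ≠ 0 := by
  rw [Serves, ← linearIndependent_equiv e, ← isUnit_iff_ne_zero, ← Matrix.isUnit_iff_isUnit_det,
    ← Matrix.linearIndependent_rows_iff_isUnit]
  rfl

/-- One repair: if a demand `a` arises from the demand `a'` by distributing the demand on `j` over
the helpers of `j`, at most `β` packets on each, and `W` serves `a`, then node `j` can be given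
contents from its helpers so that `a'` is served. -/
theorem exists_newContent_serves (W : Fin n → Fin α → Fin M → F) (H : Finset (Fin n)) (j : Fin n)
    (a a' b : Fin n → ℕ) (ha : ∀ i, a i ≤ α) (hb : ∀ i, b i ≤ β)
    (hbH : ∀ i, i ∉ H → b i = 0) (hsum : ∑ i, b i = a' j) (hj : j ∉ H)
    (hab : ∀ i, a i = (if i = j then 0 else a' i) + b i) (hW : Serves W a) :
    ∃ (σ : Fin n → Fin β → Fin α → F) (ρ : Fin α → Fin n → Fin β → F),
      Serves (Function.update W j (newContent W H σ ρ)) a' := by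
  classical
  -- The packet `t` of the newcomer is the packet number `a' (nd t) + sl t` of its helper `nd t`.
  obtain ⟨nd, sl, hsl, hinj⟩ : ∃ (nd : Fin (a' j) → Fin n) (sl : Fin (a' j) → ℕ),
      (∀ t, sl t < b (nd t)) ∧ ∀ t t', nd t = nd t' → sl t = sl t' → t = t' := by
    have e : Fin (a' j) ≃ {q : Fin n × Fin β // (q.2 : ℕ) < b q.1} :=
      Fintype.equivOfCardEq (by rw [card_demand b hb, hsum, Fintype.card_fin])
    exact ⟨fun t => (e t).1.1, fun t => (e t).1.2, fun t => (e t).2,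
      fun t t' h h' => e.injective (Subtype.ext (Prod.ext h (Fin.ext h')))⟩
  have hmem : ∀ t, nd t ∈ H := fun t => by
    by_contra hcon
    have := hsl t
    rw [hbH _ hcon] at this
    omega
  have hlt : ∀ t, a' (nd t) + sl t < a (nd t) := by
    intro t
    have hne : nd t ≠ j := fun h => hj (h ▸ hmem t)
    rw [hab, if_neg hne]
    have := hsl t
    omega
  have hltα : ∀ t, a' (nd t) + sl t < α := fun t => (hlt t).trans_le (ha _)
  refine ⟨fun i s u => if (u : ℕ) = a' i + s then 1 else 0, fun t i s =>
    if h : (t : ℕ) < a' j then if i = nd ⟨t, h⟩ ∧ (s : ℕ) = sl ⟨t, h⟩ then 1 else 0 else 0, ?_⟩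
  set ρ : Fin α → Fin n → Fin β → F := fun t i s =>
    if h : (t : ℕ) < a' j then if i = nd ⟨t, h⟩ ∧ (s : ℕ) = sl ⟨t, h⟩ then 1 else 0 else 0
  set σ : Fin n → Fin β → Fin α → F := fun i s u => if (u : ℕ) = a' i + s then 1 else 0
  have hnew : ∀ (t : Fin α) (h : (t : ℕ) < a' j),
      newContent W H σ ρ t = W (nd ⟨t, h⟩) ⟨a' (nd ⟨t, h⟩) + sl ⟨t, h⟩, hltα _⟩ := by
    intro t h
    have hs : sl ⟨t, h⟩ < β := (hsl _).trans_le (hb _)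
    unfold newContent
    rw [Finset.sum_eq_single_of_mem _ (hmem ⟨t, h⟩),
      Finset.sum_eq_single (⟨sl ⟨t, h⟩, hs⟩ : Fin β),
      Finset.sum_eq_single (⟨a' (nd ⟨t, h⟩) + sl ⟨t, h⟩, hltα _⟩ : Fin α)]
    · simp [ρ, σ, h]
    · intro u _ hu
      have : (u : ℕ) ≠ a' (nd ⟨t, h⟩) + sl ⟨t, h⟩ := fun hc => hu (Fin.ext hc)
      simp [σ, this]
    · simp
    · intro s _ hs
      have : (s : ℕ) ≠ sl ⟨t, h⟩ := fun hc => hs (Fin.ext hc)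
      simp [ρ, this]
    · simp
    · intro i _ hi
      simp [ρ, hi]
  -- The rows selected by `a'` are, up to reindexing, some of the rows selected by `a`.
  let f : {p : Fin n × Fin α // (p.2 : ℕ) < a' p.1} → {p : Fin n × Fin α // (p.2 : ℕ) < a p.1} :=
    fun p => if h : p.1.1 = j then
        ⟨(nd ⟨p.1.2, h ▸ p.2⟩, ⟨a' (nd ⟨p.1.2, h ▸ p.2⟩) + sl ⟨p.1.2, h ▸ p.2⟩, hltα _⟩), hlt _⟩
      else ⟨p.1, by have := p.2; rw [hab, if_neg h]; omega⟩
  have hfj : ∀ (t : Fin α) (h : (t : ℕ) < a' j), f ⟨(j, t), h⟩ =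
      ⟨(nd ⟨t, h⟩, ⟨a' (nd ⟨t, h⟩) + sl ⟨t, h⟩, hltα _⟩), hlt _⟩ := fun t h => by simp [f]
  have hfi : ∀ (p) (h : p.1.1 ≠ j), (f p).1 = p.1 := fun p h => by simp [f, h]
  have hclash : ∀ (t : Fin α) (h : (t : ℕ) < a' j) (p), p.1.1 ≠ j →
      f ⟨(j, t), h⟩ ≠ f p := by
    intro t h p hp heq
    have h1 := congrArg Subtype.val heq
    rw [hfj, hfi p hp] at h1
    have h2 := p.2
    rw [← h1] at h2
    dsimp only at h2
    omega
  have hf : Function.Injective f := by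
    rintro ⟨⟨i, t⟩, h⟩ ⟨⟨i', t'⟩, h'⟩ heq
    by_cases h1 : i = j <;> by_cases h2 : i' = j
    · subst h1 h2
      rw [hfj _ h, hfj _ h'] at heq
      simp only [Subtype.mk.injEq, Prod.mk.injEq, Fin.mk.injEq] at heq
      have h3 := heq.2
      rw [heq.1] at h3
      have h4 := hinj _ _ heq.1 (by omega)
      simp only [Fin.mk.injEq] at h4
      simp [Fin.ext_iff, h4]
    · subst h1
      exact absurd heq (hclash t h _ h2)
    · subst h2
      exact absurd heq.symm (hclash t' h' _ h1)
    · have h3 := congrArg Subtype.val heq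
      rw [hfi _ h1, hfi _ h2] at h3
      exact Subtype.ext h3
  have hcomp : (fun p : {p : Fin n × Fin α // (p.2 : ℕ) < a' p.1} =>
      Function.update W j (newContent W H σ ρ) p.1.1 p.1.2) = (fun p => W p.1.1 p.1.2) ∘ f := by
    funext ⟨⟨i, t⟩, h⟩
    by_cases hi : i = j
    · subst hi
      rw [Function.comp, hfj _ h, Function.update_self]
      exact hnew t h
    · rw [Function.comp, hfi _ hi, Function.update_of_ne hi]
  unfold Serves
  rw [hcomp]
  exact LinearIndependent.comp hW f hf

/-- Generic repair: over a large field, the coefficients of a repair can be chosen so that every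
demand that some choice of coefficients serves is served. -/
theorem exists_newContent_serves_all [Fintype F]
    (hF : (Fintype.card (Fin n → Fin (α + 1))) * (M * 2) < Fintype.card F)
    (W : Fin n → Fin α → Fin M → F) (H : Finset (Fin n)) (j : Fin n) :
    ∃ (σ : Fin n → Fin β → Fin α → F) (ρ : Fin α → Fin n → Fin β → F),
      ∀ a : Fin n → ℕ, (∀ i, a i ≤ α) → ∑ i, a i = M →
        (∃ σ' ρ', Serves (Function.update W j (newContent (β := β) W H σ' ρ')) a) →
        Serves (Function.update W j (newContent W H σ ρ)) a := by
  classical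
  let V := (Fin n × Fin β × Fin α) ⊕ (Fin α × Fin n × Fin β)
  let val : (Fin n → Fin β → Fin α → F) → (Fin α → Fin n → Fin β → F) → V → F := fun σ ρ =>
    Sum.elim (fun x => σ x.1 x.2.1 x.2.2) (fun x => ρ x.1 x.2.1 x.2.2)
  -- The contents of all nodes with indeterminate coefficients for the repair of `j`.
  let G : Fin n → Fin α → Fin M → MvPolynomial V F := fun i t c =>
    if i = j then ∑ i ∈ H, ∑ s, MvPolynomial.X (Sum.inr (t, i, s)) *
      ∑ u, MvPolynomial.X (Sum.inl (i, s, u)) * MvPolynomial.C (W i u c)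
    else MvPolynomial.C (W i t c)
  have hG : ∀ σ ρ i t c, MvPolynomial.eval (val σ ρ) (G i t c) =
      Function.update W j (newContent W H σ ρ) i t c := by
    intro σ ρ i t c
    by_cases hi : i = j
    · subst hi
      simp [G, newContent, val, Finset.sum_apply]
    · simp [G, hi]
  have hGdeg : ∀ i t c, (G i t c).totalDegree ≤ 2 := by
    intro i t c
    simp only [G]
    split_ifs
    · refine MvPolynomial.totalDegree_finsetSum_le fun i _ =>
        MvPolynomial.totalDegree_finsetSum_le fun s _ =>
          (MvPolynomial.totalDegree_mul _ _).trans ?_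
      have h1 : (MvPolynomial.X (Sum.inr (t, i, s)) : MvPolynomial V F).totalDegree ≤ 1 := by
        simp
      have h2 : (∑ u, MvPolynomial.X (Sum.inl (i, s, u)) * MvPolynomial.C (W i u c) :
          MvPolynomial V F).totalDegree ≤ 1 := by
        refine MvPolynomial.totalDegree_finsetSum_le fun u _ =>
          (MvPolynomial.totalDegree_mul _ _).trans ?_
        simp
      omega
    · simp
  let idx : (a : Fin n → Fin (α + 1)) → ∑ i, (a i : ℕ) = M →
      (Fin M ≃ {p : Fin n × Fin α // (p.2 : ℕ) < (a p.1 : ℕ)}) := fun a h =>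
    (Fintype.equivFinOfCardEq ((card_demand _ fun i => Nat.lt_succ_iff.1 (a i).2).trans h)).symm
  let P : (Fin n → Fin (α + 1)) → MvPolynomial V F := fun a =>
    if h : ∑ i, (a i : ℕ) = M then
      Matrix.det (Matrix.of fun m c => G (idx a h m).1.1 (idx a h m).1.2 c) else 1
  have hPserve : ∀ (a : Fin n → Fin (α + 1)), ∑ i, (a i : ℕ) = M → ∀ σ ρ,
      (MvPolynomial.eval (val σ ρ) (P a) ≠ 0 ↔
        Serves (Function.update W j (newContent W H σ ρ)) fun i => a i) := by
    intro a h σ ρ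
    simp only [P, dif_pos h]
    rw [serves_iff_det_ne_zero (idx a h), RingHom.map_det]
    have : (MvPolynomial.eval (val σ ρ)).mapMatrix
        (Matrix.of fun m c => G (idx a h m).1.1 (idx a h m).1.2 c) =
        Matrix.of fun m => Function.update W j (newContent W H σ ρ) (idx a h m).1.1
          (idx a h m).1.2 := by
      ext m c
      exact hG σ ρ _ _ c
    rw [this]
  obtain ⟨v, hv⟩ := exists_common_nonroot (Finset.univ.filter fun a => P a ≠ 0) P (M * 2)
    (by simp) (by
      intro a _
      simp only [P]
      split_ifs with h
      · simpa only [Fintype.card_fin] using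
          totalDegree_det_le (Matrix.of fun m c => G (idx a h m).1.1 (idx a h m).1.2 c) 2
            fun m c => hGdeg _ _ c
      · simp)
    (lt_of_le_of_lt (Nat.mul_le_mul_right _ (Finset.card_le_univ _)) hF)
  refine ⟨fun i s u => v (Sum.inl (i, s, u)), fun t i s => v (Sum.inr (t, i, s)), ?_⟩
  rintro a ha hM ⟨σ', ρ', h'⟩
  let a₁ : Fin n → Fin (α + 1) := fun i => ⟨a i, Nat.lt_succ_iff.2 (ha i)⟩
  have hv' : v = val (fun i s u => v (Sum.inl (i, s, u))) (fun t i s => v (Sum.inr (t, i, s))) := by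
    funext x
    rcases x with x | x <;> rfl
  have hne := (hPserve a₁ hM σ' ρ').2 h'
  have hne2 := hv a₁ (by
    simp only [Finset.mem_filter, Finset.mem_univ, true_and]
    rintro h0
    simp [h0] at hne)
  rw [hv'] at hne2
  exact (hPserve a₁ hM _ _).1 hne2

/-- Over a large field there are initial contents that serve every demand (Vandermonde). -/
theorem exists_serves_all [Fintype F] (hF : n * α ≤ Fintype.card F) :
    ∃ W : Fin n → Fin α → Fin M → F,
      ∀ a : Fin n → ℕ, (∀ i, a i ≤ α) → ∑ i, a i = M → Serves W a := by
  obtain ⟨x⟩ : Nonempty (Fin n × Fin α ↪ F) :=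
    Function.Embedding.nonempty_of_card_le (by simpa using hF)
  refine ⟨fun i t c => x (i, t) ^ (c : ℕ), fun a ha hM => ?_⟩
  let e : Fin M ≃ {p : Fin n × Fin α // (p.2 : ℕ) < a p.1} :=
    (Fintype.equivFinOfCardEq ((card_demand a ha).trans hM)).symm
  have hdet : (Matrix.vandermonde fun m => x (e m).1).det ≠ 0 := by
    rw [Matrix.det_vandermonde_ne_zero_iff]
    exact x.injective.comp (Subtype.val_injective.comp e.injective)
  exact (serves_iff_det_ne_zero e _).2 hdet

/-- If a demand of `M` packets is served, then the packets of the nodes on which the demand is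
placed determine the file. -/
theorem Serves.eq_of_dotProduct_eq {W : Fin n → Fin α → Fin M → F} {a : Fin n → ℕ}
    (hW : Serves W a) (ha : ∀ i, a i ≤ α) (hM : ∑ i, a i = M) {w w' : Fin M → F}
    (h : ∀ i, a i ≠ 0 → ∀ t, W i t ⬝ᵥ w = W i t ⬝ᵥ w') : w = w' := by
  let e : Fin M ≃ {p : Fin n × Fin α // (p.2 : ℕ) < a p.1} :=
    (Fintype.equivFinOfCardEq ((card_demand a ha).trans hM)).symm
  let Q : Matrix (Fin M) (Fin M) F := Matrix.of fun m => W (e m).1.1 (e m).1.2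
  have hQ : IsUnit Q :=
    (Matrix.isUnit_iff_isUnit_det _).2 (isUnit_iff_ne_zero.2 ((serves_iff_det_ne_zero e _).1 hW))
  refine Matrix.mulVec_injective_of_isUnit hQ ?_
  funext m
  exact h _ (fun h0 => by have := (e m).2; omega) _

end Algebra

/-! ### Codes from demands that can be traced back -/

section Code

variable {n d : ℕ}

/-- `Routable A α β M D h g a`: if the failures `g` come after the failures `h` and a data collector
then reads the nodes in `D`, the demand of `M` packets of this collector can be traced back to the
demand `a` on the nodes after the failures `h`. Undoing the failure of `j` distributes the demand on
`j` over its helpers, at most `β` packets on each, and no node ever faces a demand above `α`. -/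
def Routable (A : HelperScheme n d) (α β M : ℕ) (D : Finset (Fin n)) :
    List (Fin n) → List (Fin n) → (Fin n → ℕ) → Prop
  | _, [], a => (∀ i, a i ≤ α) ∧ (∀ i, i ∉ D → a i = 0) ∧ ∑ i, a i = M
  | h, j :: g, a => (∀ i, a i ≤ α) ∧ ∃ a', Routable A α β M D (h ++ [j]) g a' ∧
      ∃ b : Fin n → ℕ, (∀ i, b i ≤ β) ∧ (∀ i, i ∉ A.helpers h j → b i = 0) ∧ ∑ i, b i = a' j ∧
        ∀ i, a i = (if i = j then 0 else a' i) + b i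

theorem Routable.le {A : HelperScheme n d} {α β M : ℕ} {D : Finset (Fin n)} :
    ∀ {h g : List (Fin n)} {a : Fin n → ℕ}, Routable A α β M D h g a → ∀ i, a i ≤ α
  | _, [], _, H => H.1
  | _, _ :: _, _, H => H.1

theorem Routable.sum_eq {A : HelperScheme n d} {α β M : ℕ} {D : Finset (Fin n)} :
    ∀ {h g : List (Fin n)} {a : Fin n → ℕ}, Routable A α β M D h g a → ∑ i, a i = M
  | _, [], _, H => H.2.2
  | h, j :: g, a, ⟨_, a', H, b, _, _, hsum, hab⟩ => by
    rw [← H.sum_eq, Finset.sum_congr rfl fun i _ => hab i, Finset.sum_add_distrib, hsum,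
      ← Finset.sum_erase_add _ a' (Finset.mem_univ j), ← Finset.sum_erase_add _ _ (Finset.mem_univ j)]
    simp only [if_true, add_zero, Nat.add_right_cancel_iff]
    exact Finset.sum_congr rfl fun i hi => if_neg (Finset.ne_of_mem_erase hi)

variable {F : Type} [Field F] {α β M : ℕ}

/-- A rule that chooses the coefficients of a repair from the present contents of all nodes, the set
of helpers, and the failing node. -/
abbrev RepairRule (F : Type) (n α β M : ℕ) :=
  (Fin n → Fin α → Fin M → F) → Finset (Fin n) → Fin n →
    (Fin n → Fin β → Fin α → F) × (Fin α → Fin n → Fin β → F)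

/-- The contents of the nodes, as coefficient vectors, after the failures in the list, whose head is
the most recent failure. -/
def contentsAfter (A : HelperScheme n d) (W₀ : Fin n → Fin α → Fin M → F)
    (R : RepairRule F n α β M) : List (Fin n) → Fin n → Fin α → Fin M → F
  | [] => W₀
  | j :: g =>
    let W := contentsAfter A W₀ R g
    let H := A.helpers g.reverse j
    Function.update W j (newContent W H (R W H j).1 (R W H j).2)

/-- The regenerating code with initial contents `W₀` and repairs according to the rule `R`. -/
def codeOfRule (A : HelperScheme n d) (W₀ : Fin n → Fin α → Fin M → F)
    (R : RepairRule F n α β M) : RegeneratingCode F A M α β where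
  encode i := Matrix.mulVecLin (Matrix.of (W₀ i))
  send h j x := Matrix.mulVecLin (Matrix.of
    ((R (contentsAfter A W₀ R h.reverse) (A.helpers h j) j).1 x))
  restore h j :=
    { toFun := fun y t => ∑ x : {x // x ∈ A.helpers h j}, ∑ s,
        (R (contentsAfter A W₀ R h.reverse) (A.helpers h j) j).2 t x s * y x s
      map_add' := fun y z => by
        funext t
        simp only [Pi.add_apply, mul_add, Finset.sum_add_distrib]
      map_smul' := fun c y => by
        funext t
        simp only [Pi.smul_apply, smul_eq_mul, RingHom.id_apply, Finset.mul_sum]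
        exact Finset.sum_congr rfl fun x _ => Finset.sum_congr rfl fun s _ => by ring }

theorem content_codeOfRule (A : HelperScheme n d) (W₀ : Fin n → Fin α → Fin M → F)
    (R : RepairRule F n α β M) (w : Fin M → F) (h : List (Fin n)) :
    ∀ (s : ℕ) (i : Fin n) (t : Fin α), (codeOfRule A W₀ R).content w h s i t =
      contentsAfter A W₀ R (h.take s).reverse i t ⬝ᵥ w
  | 0, i, t => rfl
  | s + 1, i, t => by
    have ih := content_codeOfRule A W₀ R w h s
    rw [RegeneratingCode.content]
    split_ifs with hs hi
    · subst hi
      rw [List.take_add_one, List.getElem?_eq_getElem hs]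
      simp only [Option.toList_some, List.reverse_append, List.reverse_singleton,
        List.singleton_append, contentsAfter, Function.update_self, List.reverse_reverse]
      have ih' : (codeOfRule A W₀ R).content w h s =
          fun i t => contentsAfter A W₀ R (h.take s).reverse i t ⬝ᵥ w :=
        funext fun i => funext fun t => ih i t
      rw [ih', newContent, ← Finset.sum_coe_sort, sum_dotProduct]
      refine Finset.sum_congr rfl fun x _ => ?_
      rw [sum_dotProduct]
      refine Finset.sum_congr rfl fun u _ => ?_
      rw [smul_dotProduct, sum_dotProduct, smul_eq_mul]
      simp only [smul_dotProduct, smul_eq_mul]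
      rfl
    · rw [List.take_add_one, List.getElem?_eq_getElem hs]
      simp only [Option.toList_some, List.reverse_append, List.reverse_singleton,
        List.singleton_append, contentsAfter]
      rw [Function.update_of_ne (Ne.symm hi), ih]
    · rw [ih, List.take_of_length_le (by omega), List.take_of_length_le (by omega)]

/-- If the demand of every data collector, after any failures, can be traced back to the initial
nodes, then there is a reliable code. One finite field suffices for the infinitely many failure
patterns: whatever the future, the present contents have to serve one of the finitely many demands
with entries at most `α`. -/
theorem exists_reliable_code (A : HelperScheme n d) (k α β M : ℕ)
    (hR : ∀ (g : List (Fin n)) (D : Finset (Fin n)), D.card = k →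
      ∃ a, Routable A α β M D [] g a) :
    ∃ (F : Type) (_ : Field F) (_ : Finite F) (C : RegeneratingCode F A M α β), C.Reliable k := by
  obtain ⟨p, hp, hprime⟩ := Nat.exists_infinite_primes
    (Fintype.card (Fin n → Fin (α + 1)) * (M * 2) + n * α + 1)
  have : Fact p.Prime := ⟨hprime⟩
  refine ⟨ZMod p, inferInstance, inferInstance, ?_⟩
  have hcard : Fintype.card (ZMod p) = p := ZMod.card p
  obtain ⟨W₀, hW₀⟩ := exists_serves_all (F := ZMod p) (n := n) (α := α) (M := M)
    (by rw [hcard]; omega)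
  choose σ ρ hσρ using fun (W : Fin n → Fin α → Fin M → ZMod p) (H : Finset (Fin n)) (j : Fin n) =>
    exists_newContent_serves_all (β := β) (by rw [hcard]; omega) W H j
  let R : RepairRule (ZMod p) n α β M := fun W H j => (σ W H j, ρ W H j)
  have inv : ∀ (h : List (Fin n)) (g : List (Fin n)) (D : Finset (Fin n)), D.card = k →
      ∃ a, Routable A α β M D h.reverse g a ∧ Serves (contentsAfter A W₀ R h) a := by
    intro h
    induction h with
    | nil =>
      intro g D hD
      obtain ⟨a, ha⟩ := hR g D hD
      exact ⟨a, ha, hW₀ a ha.le ha.sum_eq⟩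
    | cons j h ih =>
      intro g D hD
      obtain ⟨a, ⟨ha, a', ha', b, hb, hbH, hsum, hab⟩, hs⟩ := ih (j :: g) D hD
      refine ⟨a', by simpa using ha', ?_⟩
      exact hσρ _ _ _ a' ha'.le ha'.sum_eq (exists_newContent_serves _ _ j a a' b ha hb hbH hsum
        (A.not_mem_helpers _ _) hab hs)
  refine ⟨codeOfRule A W₀ R, fun h D hD => ?_⟩
  obtain ⟨a, ⟨ha, haD, hM⟩, hs⟩ := inv h.reverse [] D hD
  have hinj : Function.Injective fun (w : Fin M → ZMod p) (x : {x // x ∈ D}) =>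
      (codeOfRule A W₀ R).content w h h.length x := by
    intro w w' hww
    refine hs.eq_of_dotProduct_eq ha hM fun i hi t => ?_
    have hiD : i ∈ D := by
      by_contra hcon
      exact hi (haD i hcon)
    have := congrFun (congrFun hww ⟨i, hiD⟩) t
    simpa only [content_codeOfRule, List.take_length] using this
  exact ⟨Function.invFun _, Function.leftInverse_invFun hinj⟩

end Code

/-! ### Active storage nodes -/

section Active

variable {n : ℕ}

/-- The node whose role a storage node plays. -/
def roleOf (h : List (Fin n)) : StorageNode n h.length → Fin n
  | .inl i => i
  | .inr s => h[s]

/-- The time at which a storage node is created; the initial nodes come, in their order, before the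
newcomers. -/
def birth {T : ℕ} : StorageNode n T → ℕ
  | .inl i => i
  | .inr s => n + s

theorem birth_injective {T : ℕ} : Function.Injective (birth : StorageNode n T → ℕ) := by
  rintro (i | s) (j | t) h <;> simp only [birth] at h
  · exact congrArg _ (Fin.ext h)
  · omega
  · omega
  · exact congrArg _ (Fin.ext (by omega))

theorem roleOf_activeNode (h : List (Fin n)) : ∀ s i, roleOf h (activeNode h s i) = i
  | 0, i => rfl
  | s + 1, i => by
    rw [activeNode]
    split_ifs with hs hi
    · exact hi
    · exact roleOf_activeNode h s i
    · exact roleOf_activeNode h s i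

theorem activeNode_injective (h : List (Fin n)) (s : ℕ) : Function.Injective (activeNode h s) :=
  Function.LeftInverse.injective (roleOf_activeNode h s)

theorem birth_activeNode_lt (h : List (Fin n)) : ∀ s i, birth (activeNode h s i) < n + s
  | 0, i => i.2
  | s + 1, i => by
    rw [activeNode]
    split_ifs with hs hi
    · simp only [birth]; omega
    · exact (birth_activeNode_lt h s i).trans (by omega)
    · exact (birth_activeNode_lt h s i).trans (by omega)

end Active

/-! ### Cuts of information flow graphs -/

section Cut

variable {n d : ℕ}

/-- The helpers of the newcomer `s` that are not in `X`. -/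
def outerHelpers (A : HelperScheme n d) (h : List (Fin n))
    (X : Finset (StorageNode n h.length)) (s : Fin h.length) : Finset (Fin n) :=
  (A.helpers (h.take s) h[s]).filter fun i => activeNode h s i ∉ X

/-- The value of a cut of finite value of the information flow graph: `X` consists of the storage
nodes whose output vertex, and `Y` of the newcomers whose input vertex, is on the side of the
collector. The inputs of the initial nodes are on the side of the source. -/
def cutCost {R : Type*} [CommSemiring R] (A : HelperScheme n d) (α β : R) (h : List (Fin n))
    (X : Finset (StorageNode n h.length)) (Y : Finset (Fin h.length)) : R :=
  ((X \ Y.map Function.Embedding.inr).card : R) * α +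
    ∑ s ∈ Y, ((outerHelpers A h X s).card : R) * β

theorem sum_vertex {k T : ℕ} {R : Type*} [AddCommMonoid R] (g : IFGVertex n k T → R) :
    ∑ v, g v = g .source + (∑ x, g (.inp x) + (∑ x, g (.out x) + ∑ D, g (.collector D))) := by
  rw [← (IFGVertex.proxyTypeEquiv n k T).sum_comp g]
  simp only [Fintype.sum_sum_type, Finset.univ_unique, Finset.sum_singleton]
  rfl

open Classical in
/-- The value of a cut, sorted by the four kinds of edges: from the source to the initial nodes,
inside storage nodes, from helpers to newcomers, and to the collectors. -/
theorem cut_sum_eq (A : HelperScheme n d) (k : ℕ) (α β : ℝ≥0) (h : List (Fin n))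
    (S : Set (IFGVertex n k h.length)) :
    (∑ u, ∑ v, if u ∈ S ∧ v ∉ S then ifgCapacity A k α β h u v else 0) =
      (∑ i, if .source ∈ S ∧ .inp (.inl i) ∉ S then ⊤ else 0) +
      (∑ x, if .inp x ∈ S ∧ .out x ∉ S then (α : ℝ≥0∞) else 0) +
      (∑ s : Fin h.length, ∑ x, if (.out x ∈ S ∧ .inp (.inr s) ∉ S) ∧
        ∃ i ∈ A.helpers (h.take s) h[s], x = activeNode h s i then (β : ℝ≥0∞) else 0) +
      ∑ x, ∑ D : {D : Finset (Fin n) // D.card = k}, if (.out x ∈ S ∧ .collector D ∉ S) ∧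
        ∃ i ∈ D.1, x = activeNode h h.length i then ⊤ else 0 := by
  simp only [sum_vertex, Fintype.sum_sum_type (f := fun x => ite (_ ∈ S ∧ .inp x ∉ S) _ _)]
  simp only [ifgCapacity, ite_self, Finset.sum_const_zero, add_zero, zero_add]
  rw [Finset.sum_comm (s := Finset.univ (α := Fin h.length))]
  simp only [← ite_and, Finset.sum_add_distrib, add_assoc]
  congr 2
  refine Finset.sum_congr rfl fun x _ => ?_
  rw [Finset.sum_eq_single x]
  · simp
  · intro y _ hy
    simp [Ne.symm hy]
  · simp

open Classical in
theorem minCut_le_cutCost (A : HelperScheme n d) {k : ℕ} (α β : ℝ≥0) (h : List (Fin n))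
    (D : {D : Finset (Fin n) // D.card = k}) (X : Finset (StorageNode n h.length))
    (Y : Finset (Fin h.length)) (hX : ∀ i ∈ D.1, activeNode h h.length i ∈ X) :
    minCut (ifgCapacity A k α β h) .source (.collector D) ≤ cutCost A (α : ℝ≥0∞) β h X Y := by
  let S : Set (IFGVertex n k h.length) := fun v => match v with
    | .source => True
    | .inp x => x ∉ Y.map Function.Embedding.inr
    | .out x => x ∉ X
    | .collector D' => D' ≠ D
  have h1 : (.source : IFGVertex n k h.length) ∈ S := trivial
  have h2 : ∀ x, (.inp x : IFGVertex n k h.length) ∈ S ↔ x ∉ Y.map Function.Embedding.inr :=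
    fun x => Iff.rfl
  have h3 : ∀ x, (.out x : IFGVertex n k h.length) ∈ S ↔ x ∉ X := fun x => Iff.rfl
  have h4 : ∀ D', (.collector D' : IFGVertex n k h.length) ∈ S ↔ D' ≠ D := fun x => Iff.rfl
  refine (iInf₂_le_of_le S h1 (iInf_le_of_le (fun hc => hc rfl) le_rfl)).trans (le_of_eq ?_)
  rw [cut_sum_eq, cutCost, Finset.sum_eq_zero, Finset.sum_eq_zero (s := Finset.univ)
    (f := fun x => ∑ D : {D : Finset (Fin n) // D.card = k}, _), zero_add, add_zero]
  · congr 1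
    · rw [← Finset.sum_filter, Finset.sum_const, nsmul_eq_mul]
      congr 3
      ext x
      simp only [h2, h3, Finset.mem_filter, Finset.mem_univ, true_and, Finset.mem_sdiff, not_not]
      exact and_comm
    · rw [← Finset.sum_subset (Finset.subset_univ Y)]
      · refine Finset.sum_congr rfl fun s hs => ?_
        rw [← Finset.sum_filter, Finset.sum_const, nsmul_eq_mul]
        congr 2
        rw [← Finset.card_image_of_injective _ (activeNode_injective h s)]
        congr 1
        ext x
        simp only [h2, h3, Finset.mem_filter, Finset.mem_univ, true_and, Finset.mem_image,
          outerHelpers, not_not, Finset.mem_map]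
        constructor
        · rintro ⟨⟨hx, -⟩, i, hi, rfl⟩
          exact ⟨i, ⟨hi, hx⟩, rfl⟩
        · rintro ⟨i, ⟨hi, hx⟩, rfl⟩
          exact ⟨⟨hx, s, hs, rfl⟩, i, hi, rfl⟩
      · intro s _ hs
        refine Finset.sum_eq_zero fun x _ => if_neg ?_
        rintro ⟨⟨-, h5⟩, -⟩
        simp [h2, hs] at h5
  · intro x _
    refine Finset.sum_eq_zero fun D' _ => if_neg ?_
    rintro ⟨⟨h5, h6⟩, i, hi, rfl⟩
    rw [h4, not_not] at h6
    subst h6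
    exact h5 (hX i hi)
  · intro i _
    refine if_neg ?_
    rintro ⟨-, h5⟩
    simp [h2] at h5

open Classical in
/-- The value of every cut is bounded below by some `cutCost`; if it is infinite, any will do. -/
theorem exists_cutCost_le (A : HelperScheme n d) {k : ℕ} (α β : ℝ≥0) (h : List (Fin n))
    (D : {D : Finset (Fin n) // D.card = k}) (S : Set (IFGVertex n k h.length))
    (hs : .source ∈ S) (hD : .collector D ∉ S) :
    ∃ (X : Finset (StorageNode n h.length)) (Y : Finset (Fin h.length)),
      (∀ i ∈ D.1, activeNode h h.length i ∈ X) ∧ cutCost A (α : ℝ≥0∞) β h X Y ≤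
        ∑ u, ∑ v, if u ∈ S ∧ v ∉ S then ifgCapacity A k α β h u v else 0 := by
  by_cases htop : (∑ u, ∑ v, if u ∈ S ∧ v ∉ S then ifgCapacity A k α β h u v else 0) = ⊤
  · exact ⟨Finset.univ, ∅, fun _ _ => Finset.mem_univ _, htop ▸ le_top⟩
  rw [cut_sum_eq] at htop ⊢
  simp only [ENNReal.add_eq_top, not_or, ENNReal.sum_eq_top, not_exists] at htop
  have h1 : ∀ i, (.inp (.inl i) : IFGVertex n k h.length) ∈ S := fun i => by
    have := htop.1.1.1 i
    simpa [hs] using this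
  have h2 : ∀ i ∈ D.1, (.out (activeNode h h.length i) : IFGVertex n k h.length) ∉ S := by
    intro i hi hcon
    refine htop.2 (activeNode h h.length i) ⟨Finset.mem_univ _, D, Finset.mem_univ _, ?_⟩
    rw [if_pos ⟨⟨hcon, hD⟩, i, hi, rfl⟩]
  refine ⟨Finset.univ.filter fun x => .out x ∉ S, Finset.univ.filter fun s => .inp (.inr s) ∉ S,
    fun i hi => by simpa using h2 i hi, le_trans ?_ le_self_add⟩
  rw [add_assoc]
  refine le_trans ?_ le_add_self
  rw [cutCost]
  refine add_le_add ?_ ?_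
  · rw [← Finset.sum_filter, Finset.sum_const, nsmul_eq_mul]
    refine mul_le_mul' (Nat.cast_le.2 (Finset.card_le_card fun x => ?_)) le_rfl
    rcases x with i | s <;> simp [h1]
    tauto
  · rw [Finset.sum_filter]
    refine Finset.sum_le_sum fun s _ => ?_
    by_cases h3 : (.inp (.inr s) : IFGVertex n k h.length) ∈ S
    · rw [if_neg (not_not.2 h3)]
      exact zero_le
    · rw [if_pos h3, ← Finset.sum_filter, Finset.sum_const, nsmul_eq_mul]
      gcongr
      rw [← Finset.card_image_of_injective _ (activeNode_injective h s)]
      refine Finset.card_le_card fun x hx => ?_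
      simp only [Finset.mem_image, outerHelpers, Finset.mem_filter, Finset.mem_univ, true_and,
        not_not] at hx ⊢
      obtain ⟨i, ⟨hi, hx⟩, rfl⟩ := hx
      exact ⟨⟨hx, h3⟩, i, hi, rfl⟩

theorem exists_minCut_eq_cutCost (A : HelperScheme n d) {k : ℕ} (α β : ℝ≥0) (h : List (Fin n))
    (D : {D : Finset (Fin n) // D.card = k}) :
    ∃ (X : Finset (StorageNode n h.length)) (Y : Finset (Fin h.length)),
      (∀ i ∈ D.1, activeNode h h.length i ∈ X) ∧
      minCut (ifgCapacity A k α β h) .source (.collector D) = cutCost A (α : ℝ≥0∞) β h X Y := by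
  classical
  obtain ⟨⟨X, Y⟩, hX, hmin⟩ := Finset.exists_min_image
    (Finset.univ.filter fun p : Finset (StorageNode n h.length) × Finset (Fin h.length) =>
      ∀ i ∈ D.1, activeNode h h.length i ∈ p.1)
    (fun p => cutCost A (α : ℝ≥0∞) β h p.1 p.2) ⟨(Finset.univ, ∅), by simp⟩
  simp only [Finset.mem_filter, Finset.mem_univ, true_and] at hX hmin
  refine ⟨X, Y, hX, (minCut_le_cutCost A α β h D X Y hX).antisymm ?_⟩
  refine le_iInf fun S => le_iInf fun hs => le_iInf fun hD => ?_
  obtain ⟨X', Y', hX', hle⟩ := exists_cutCost_le A α β h D S hs hD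
  exact (hmin (X', Y') hX').trans hle

end Cut

/-! ### Tracing demands back in time -/

section Routing

theorem card_add_card_le_of_union_inter {ι : Type*} [DecidableEq ι] {A B P Q : Finset ι}
    (h₁ : A ∪ B ⊆ P ∪ Q) (h₂ : A ∩ B ⊆ P ∩ Q) : A.card + B.card ≤ P.card + Q.card := by
  rw [← Finset.card_union_add_card_inter A B, ← Finset.card_union_add_card_inter P Q]
  exact add_le_add (Finset.card_le_card h₁) (Finset.card_le_card h₂)

/-- Let `a` lie below the submodular function `f`. Then `a` can be raised by `m` in total, by at most
`β` at each element of `H` and nowhere else, so that it still lies below `f`, provided that no set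
`S` forbids it. If no further unit can be placed, then the union of the tight sets is a set that
forbids it. -/
theorem exists_raise_of_submodular {ι : Type*} [Fintype ι] [DecidableEq ι] (f : Finset ι → ℕ)
    (hf0 : f ∅ = 0) (hf : ∀ S T, f (S ∪ T) + f (S ∩ T) ≤ f S + f T) (a : ι → ℕ)
    (ha : ∀ S, ∑ i ∈ S, a i ≤ f S) (H : Finset ι) (β m : ℕ)
    (hm : ∀ S, m + ∑ i ∈ S, a i ≤ f S + (H \ S).card * β) :
    ∃ b : ι → ℕ, (∀ i, b i ≤ β) ∧ (∀ i, i ∉ H → b i = 0) ∧ ∑ i, b i = m ∧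
      ∀ S, ∑ i ∈ S, (a i + b i) ≤ f S := by
  induction m with
  | zero => exact ⟨0, by simp, by simp, by simp, by simpa using ha⟩
  | succ m ih =>
    obtain ⟨b, hb, hbH, hsum, hbf⟩ := ih fun S => by have := hm S; omega
    by_contra hcon
    have htight : ∀ i ∈ H, b i < β → ∃ S, i ∈ S ∧ ∑ l ∈ S, (a l + b l) = f S := by
      intro i hi hiβ
      by_contra! hno
      refine hcon ⟨fun l => b l + if l = i then 1 else 0, ?_, ?_, ?_, ?_⟩
      · intro l
        dsimp only
        split_ifs with hl
        · subst hl; omega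
        · exact hb l
      · intro l hl
        have : l ≠ i := fun h => hl (h ▸ hi)
        simp [hbH l hl, this]
      · simp [Finset.sum_add_distrib, hsum]
      · intro S
        simp only [← add_assoc]
        rw [Finset.sum_add_distrib, Finset.sum_ite_eq']
        split_ifs with hS
        · have := hno S hS
          have := hbf S
          omega
        · exact hbf S
    choose! t ht htf using htight
    have hunion : ∀ U : Finset ι, (∀ i ∈ U, i ∈ H ∧ b i < β) →
        ∑ l ∈ U.biUnion t, (a l + b l) = f (U.biUnion t) := by
      intro U
      induction U using Finset.induction_on with
      | empty => simp [hf0]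
      | insert i U _ ihU =>
        intro hU
        rw [Finset.biUnion_insert]
        have h1 := ihU fun l hl => hU l (Finset.mem_insert_of_mem hl)
        have h2 := htf i (hU i (Finset.mem_insert_self _ _)).1 (hU i (Finset.mem_insert_self _ _)).2
        have h3 := Finset.sum_union_inter (s₁ := t i) (s₂ := U.biUnion t) (f := fun l => a l + b l)
        have h4 := hf (t i) (U.biUnion t)
        have h5 := hbf (t i ∪ U.biUnion t)
        have h6 := hbf (t i ∩ U.biUnion t)
        omega
    set S := (H.filter fun i => b i < β).biUnion t
    have hS : ∑ l ∈ S, (a l + b l) = f S := hunion (H.filter fun i => b i < β) (by simp)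
    have h1 : ∀ i ∈ H \ S, b i = β := by
      intro i hi
      rw [Finset.mem_sdiff] at hi
      by_contra hne
      have hlt : b i < β := lt_of_le_of_ne (hb i) hne
      exact hi.2 (Finset.mem_biUnion.2 ⟨i, Finset.mem_filter.2 ⟨hi.1, hlt⟩, ht i hi.1 hlt⟩)
    have h2 : ∑ i ∈ H \ S, b i = (H \ S).card * β := by
      rw [Finset.sum_congr rfl h1, Finset.sum_const, smul_eq_mul]
    have h3 : ∑ i ∈ H \ S, b i + ∑ i ∈ S, b i ≤ m := by
      rw [← hsum, ← Finset.sum_union Finset.sdiff_disjoint]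
      exact Finset.sum_le_sum_of_subset (Finset.subset_univ _)
    have h4 := hm S
    rw [Finset.sum_add_distrib] at hS
    omega

variable {n d : ℕ}

theorem outerHelpers_card_add_le (A : HelperScheme n d) (h : List (Fin n))
    (X X' : Finset (StorageNode n h.length)) (s : Fin h.length) :
    (outerHelpers A h (X ∪ X') s).card + (outerHelpers A h (X ∩ X') s).card ≤
      (outerHelpers A h X s).card + (outerHelpers A h X' s).card := by
  refine card_add_card_le_of_union_inter ?_ ?_ <;> intro i <;>
    simp only [outerHelpers, Finset.mem_union, Finset.mem_inter, Finset.mem_filter] <;> tauto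

theorem outerHelpers_anti (A : HelperScheme n d) (h : List (Fin n))
    {X X' : Finset (StorageNode n h.length)} (hX : X ⊆ X') (s : Fin h.length) :
    (outerHelpers A h X' s).card ≤ (outerHelpers A h X s).card :=
  Finset.card_le_card fun i hi => by
    simp only [outerHelpers, Finset.mem_filter] at hi ⊢
    exact ⟨hi.1, fun hc => hi.2 (hX hc)⟩

theorem cutCost_submodular (A : HelperScheme n d) (α β : ℕ) (h : List (Fin n))
    (X X' : Finset (StorageNode n h.length)) (Y Y' : Finset (Fin h.length)) :
    cutCost A α β h (X ∪ X') (Y ∪ Y') + cutCost A α β h (X ∩ X') (Y ∩ Y') ≤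
      cutCost A α β h X Y + cutCost A α β h X' Y' := by
  have h1 : ((X ∪ X') \ (Y ∪ Y').map Function.Embedding.inr).card +
      ((X ∩ X') \ (Y ∩ Y').map Function.Embedding.inr).card ≤
      (X \ Y.map Function.Embedding.inr).card + (X' \ Y'.map Function.Embedding.inr).card := by
    refine card_add_card_le_of_union_inter ?_ ?_ <;> rintro (i | s) <;>
      simp only [Finset.mem_union, Finset.mem_inter, Finset.mem_sdiff, Finset.mem_map,
        Function.Embedding.inr_apply, Sum.inr.injEq, exists_eq_right, reduceCtorEq, and_false,
        exists_false, not_false_eq_true, and_true] <;> tauto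
  have h2 : ∀ (X : Finset (StorageNode n h.length)) (Y : Finset (Fin h.length)),
      ∑ s ∈ Y, (outerHelpers A h X s).card * β =
        ∑ s, if s ∈ Y then (outerHelpers A h X s).card * β else 0 := fun X Y => by
    rw [Finset.sum_ite_mem, Finset.univ_inter]
  have h3 : ∑ s ∈ Y ∪ Y', (outerHelpers A h (X ∪ X') s).card * β +
      ∑ s ∈ Y ∩ Y', (outerHelpers A h (X ∩ X') s).card * β ≤
      ∑ s ∈ Y, (outerHelpers A h X s).card * β + ∑ s ∈ Y', (outerHelpers A h X' s).card * β := by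
    rw [h2, h2, h2, h2, ← Finset.sum_add_distrib, ← Finset.sum_add_distrib]
    refine Finset.sum_le_sum fun s _ => ?_
    by_cases hY : s ∈ Y <;> by_cases hY' : s ∈ Y' <;> simp only [Finset.mem_union,
      Finset.mem_inter, hY, hY', or_true, true_or, and_true, and_false, or_self, if_true,
      if_false, add_zero, zero_add, le_refl]
    · rw [← add_mul, ← add_mul]
      exact Nat.mul_le_mul_right _ (outerHelpers_card_add_le A h X X' s)
    · exact Nat.mul_le_mul_right _ (outerHelpers_anti A h Finset.subset_union_left s)
    · exact Nat.mul_le_mul_right _ (outerHelpers_anti A h Finset.subset_union_right s)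
  simp only [cutCost, Nat.cast_id]
  have h4 := Nat.mul_le_mul_right α h1
  rw [add_mul, add_mul] at h4
  omega

/-- The least value of a cut that separates the source from the outputs of the storage nodes that
play the roles in `T` after the first `s` failures. -/
noncomputable def sepCost (A : HelperScheme n d) (α β : ℕ) (h : List (Fin n)) (s : ℕ)
    (T : Finset (Fin n)) : ℕ :=
  sInf {c | ∃ X Y, (∀ i ∈ T, activeNode h s i ∈ X) ∧ cutCost A α β h X Y = c}

theorem sepCost_le {A : HelperScheme n d} {α β : ℕ} {h : List (Fin n)} {s : ℕ}
    {T : Finset (Fin n)} {X : Finset (StorageNode n h.length)} (Y : Finset (Fin h.length))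
    (hX : ∀ i ∈ T, activeNode h s i ∈ X) : sepCost A α β h s T ≤ cutCost A α β h X Y :=
  Nat.sInf_le ⟨X, Y, hX, rfl⟩

theorem exists_sepCost_eq (A : HelperScheme n d) (α β : ℕ) (h : List (Fin n)) (s : ℕ)
    (T : Finset (Fin n)) : ∃ X Y, (∀ i ∈ T, activeNode h s i ∈ X) ∧
      cutCost A α β h X Y = sepCost A α β h s T :=
  Nat.sInf_mem
    (s := {c | ∃ X Y, (∀ i ∈ T, activeNode h s i ∈ X) ∧ cutCost A α β h X Y = c})
    ⟨_, Finset.univ, ∅, fun _ _ => Finset.mem_univ _, rfl⟩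

theorem sepCost_empty (A : HelperScheme n d) (α β : ℕ) (h : List (Fin n)) (s : ℕ) :
    sepCost A α β h s ∅ = 0 := by
  have := sepCost_le (A := A) (α := α) (β := β) (h := h) (s := s) (T := ∅) (X := ∅) ∅ (by simp)
  simpa [cutCost] using this

theorem sepCost_singleton_le (A : HelperScheme n d) (α β : ℕ) (h : List (Fin n)) (s : ℕ)
    (i : Fin n) : sepCost A α β h s {i} ≤ α := by
  have := sepCost_le (A := A) (α := α) (β := β) (h := h) (s := s) (T := {i})
    (X := {activeNode h s i}) ∅ (by simp)
  simpa [cutCost] using this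

theorem sepCost_mono (A : HelperScheme n d) (α β : ℕ) (h : List (Fin n)) (s : ℕ)
    {T T' : Finset (Fin n)} (hT : T ⊆ T') : sepCost A α β h s T ≤ sepCost A α β h s T' := by
  obtain ⟨X, Y, hX, hc⟩ := exists_sepCost_eq A α β h s T'
  rw [← hc]
  exact sepCost_le Y fun i hi => hX i (hT hi)

theorem sepCost_submodular (A : HelperScheme n d) (α β : ℕ) (h : List (Fin n)) (s : ℕ)
    (T T' : Finset (Fin n)) :
    sepCost A α β h s (T ∪ T') + sepCost A α β h s (T ∩ T') ≤
      sepCost A α β h s T + sepCost A α β h s T' := by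
  obtain ⟨X, Y, hX, hc⟩ := exists_sepCost_eq A α β h s T
  obtain ⟨X', Y', hX', hc'⟩ := exists_sepCost_eq A α β h s T'
  rw [← hc, ← hc']
  refine (add_le_add (sepCost_le (Y ∪ Y') ?_) (sepCost_le (Y ∩ Y') ?_)).trans
    (cutCost_submodular A α β h X X' Y Y')
  · intro i hi
    rcases Finset.mem_union.1 hi with hi | hi
    · exact Finset.mem_union_left _ (hX i hi)
    · exact Finset.mem_union_right _ (hX' i hi)
  · intro i hi
    rw [Finset.mem_inter] at hi
    exact Finset.mem_inter.2 ⟨hX i hi.1, hX' i hi.2⟩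

theorem sepCost_succ_of_notMem (A : HelperScheme n d) (α β : ℕ) (h : List (Fin n)) {s : ℕ}
    (hs : s < h.length) {T : Finset (Fin n)} (hT : h[s] ∉ T) :
    sepCost A α β h (s + 1) T ≤ sepCost A α β h s T := by
  obtain ⟨X, Y, hX, hc⟩ := exists_sepCost_eq A α β h s T
  rw [← hc]
  refine sepCost_le Y fun i hi => ?_
  have hne : h[s] ≠ i := fun h => hT (h ▸ hi)
  rw [activeNode, dif_pos hs, if_neg hne]
  exact hX i hi

theorem sepCost_succ_insert (A : HelperScheme n d) (α β : ℕ) (h : List (Fin n)) {s : ℕ}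
    (hs : s < h.length) (T : Finset (Fin n)) :
    sepCost A α β h (s + 1) (insert h[s] T) ≤
      sepCost A α β h s T + (A.helpers (h.take s) h[s] \ T).card * β := by
  obtain ⟨X, Y, hX, hc⟩ := exists_sepCost_eq A α β h s T
  rw [← hc]
  refine (sepCost_le (X := insert (Sum.inr ⟨s, hs⟩) X) (insert ⟨s, hs⟩ Y) ?_).trans ?_
  · intro i hi
    rw [activeNode, dif_pos hs]
    split_ifs with h1
    · exact Finset.mem_insert_self _ _
    · refine Finset.mem_insert_of_mem (hX i ?_)
      exact (Finset.mem_insert.1 hi).resolve_left (Ne.symm h1)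
  simp only [cutCost, Nat.cast_id, add_assoc]
  refine add_le_add (Nat.mul_le_mul_right _ (Finset.card_le_card ?_)) ?_
  · rintro (i | t) <;> simp
    tauto
  have h1 : ∀ t, (outerHelpers A h (insert (Sum.inr ⟨s, hs⟩) X) t).card * β ≤
      (outerHelpers A h X t).card * β := fun t =>
    Nat.mul_le_mul_right _ (outerHelpers_anti A h (Finset.subset_insert _ _) t)
  have h2 : (outerHelpers A h (insert (Sum.inr ⟨s, hs⟩) X) ⟨s, hs⟩).card * β ≤
      (A.helpers (h.take s) h[s] \ T).card * β := by
    refine Nat.mul_le_mul_right _ (Finset.card_le_card fun i hi => ?_)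
    simp only [outerHelpers, Finset.mem_filter, Finset.mem_insert, not_or] at hi
    exact Finset.mem_sdiff.2 ⟨hi.1, fun hc => hi.2.2 (hX i hc)⟩
  by_cases hY : (⟨s, hs⟩ : Fin h.length) ∈ Y
  · rw [Finset.insert_eq_of_mem hY]
    exact (Finset.sum_le_sum fun t _ => h1 t).trans le_self_add
  · rw [Finset.sum_insert hY, add_comm]
    exact add_le_add (Finset.sum_le_sum fun t _ => h1 t) h2

/-- The integral max-flow min-cut theorem for information flow graphs: if no cut has a value below
`M`, then the demand of `M` packets can be traced back to the initial nodes. Time is traversed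
backwards, keeping the demand below the submodular function `sepCost`. -/
theorem exists_routable (A : HelperScheme n d) (α β M : ℕ) (h : List (Fin n))
    (D : Finset (Fin n)) (hM : M ≤ sepCost A α β h h.length D) :
    ∃ a, Routable A α β M D [] h a := by
  suffices key : ∀ r s, s + r = h.length → ∃ a, Routable A α β M D (h.take s) (h.drop s) a ∧
      ∀ T, ∑ i ∈ T, a i ≤ sepCost A α β h s T by
    obtain ⟨a, ha, -⟩ := key h.length 0 (by omega)
    exact ⟨a, ha⟩
  have hle : ∀ (a : Fin n → ℕ) s, (∀ T, ∑ i ∈ T, a i ≤ sepCost A α β h s T) → ∀ i, a i ≤ α :=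
    fun a s ha i => by simpa using (ha {i}).trans (sepCost_singleton_le A α β h s i)
  intro r
  induction r with
  | zero =>
    intro s hs
    obtain rfl : s = h.length := by omega
    obtain ⟨a, -, haD, hsum, ha⟩ := exists_raise_of_submodular (sepCost A α β h h.length)
      (sepCost_empty _ _ _ _ _) (sepCost_submodular _ _ _ _ _) 0 (by simp) D M M (by
        intro S
        by_cases hS : D ⊆ S
        · simpa using (hM.trans (sepCost_mono A α β h _ hS)).trans le_self_add
        · have : 1 ≤ (D \ S).card := Finset.card_pos.2 (Finset.sdiff_nonempty.2 hS)
          have := Nat.mul_le_mul_right M this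
          simp only [Pi.zero_apply, Finset.sum_const_zero]
          omega)
    simp only [Pi.zero_apply, zero_add] at ha
    rw [List.take_length, List.drop_length]
    exact ⟨a, ⟨hle a _ ha, haD, hsum⟩, ha⟩
  | succ r ih =>
    intro s hs
    obtain ⟨a', hR, ha'⟩ := ih (s + 1) (by omega)
    have hlt : s < h.length := by omega
    have hsub : ∀ T, ∑ i ∈ T, (if i = h[s] then 0 else a' i) = ∑ i ∈ T.erase h[s], a' i := by
      intro T
      rw [← Finset.sum_erase T (a := h[s]) (by simp)]
      exact Finset.sum_congr rfl fun i hi => if_neg (Finset.ne_of_mem_erase hi)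
    obtain ⟨b, hb, hbH, hsum, ha⟩ := exists_raise_of_submodular (sepCost A α β h s)
      (sepCost_empty _ _ _ _ _) (sepCost_submodular _ _ _ _ _)
      (fun i => if i = h[s] then 0 else a' i) (by
        intro T
        rw [hsub]
        exact ((ha' _).trans (sepCost_succ_of_notMem A α β h hlt (Finset.notMem_erase _ _))).trans
          (sepCost_mono A α β h s (Finset.erase_subset _ _)))
      (A.helpers (h.take s) h[s]) β (a' h[s]) (by
        intro T
        rw [hsub, ← Finset.sum_insert (Finset.notMem_erase _ _)]
        refine ((ha' _).trans (sepCost_succ_insert A α β h hlt _)).trans ?_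
        refine add_le_add (sepCost_mono A α β h s (Finset.erase_subset _ _))
          (Nat.mul_le_mul_right _ (Finset.card_le_card fun i hi => ?_))
        -- The failed node is not among its own helpers.
        have hne : i ≠ h[s] := fun hc => A.not_mem_helpers _ _ (hc ▸ (Finset.mem_sdiff.1 hi).1)
        simp only [Finset.mem_sdiff, Finset.mem_erase] at hi ⊢
        exact ⟨hi.1, fun hc => hi.2 ⟨hne, hc⟩⟩)
    refine ⟨fun i => (if i = h[s] then 0 else a' i) + b i, ?_, ha⟩
    rw [List.drop_eq_getElem_cons hlt]
    refine ⟨hle _ s ha, a', ?_, b, hb, hbH, hsum, fun i => rfl⟩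
    rwa [List.take_append_getElem]

end Routing

/-! ### The least cut is reached by codes -/

section Capacity

variable {n d : ℕ}

theorem cutCost_natCast (A : HelperScheme n d) (α β : ℕ) (h : List (Fin n))
    (X : Finset (StorageNode n h.length)) (Y : Finset (Fin h.length)) :
    cutCost A (((α : ℝ≥0)) : ℝ≥0∞) ((β : ℝ≥0) : ℝ≥0∞) h X Y = (cutCost A α β h X Y : ℕ) := by
  simp [cutCost]

/-- Linear codes over a finite field reach the least value of a cut. -/
theorem exists_reliable_code_of_le_minCut (A : HelperScheme n d) (k α β M : ℕ)
    (hM : ∀ c ∈ minCutValues A k α β, (M : ℝ≥0∞) ≤ c) :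
    ∃ (F : Type) (_ : Field F) (_ : Finite F) (C : RegeneratingCode F A M α β), C.Reliable k := by
  refine exists_reliable_code A k α β M fun h D hD => exists_routable A α β M h D ?_
  obtain ⟨X, Y, hX, hc⟩ := exists_sepCost_eq A α β h h.length D
  rw [← hc, ← Nat.cast_le (α := ℝ≥0∞), ← cutCost_natCast]
  exact (hM _ ⟨h, ⟨D, hD⟩, rfl⟩).trans (minCut_le_cutCost A α β h ⟨D, hD⟩ X Y hX)

theorem exists_isLeast_minCutValues (A : HelperScheme n d) {k : ℕ} (hk : k ≤ n) (α β : ℕ) :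
    ∃ c, IsLeast (minCutValues A k α β) c := by
  have hnat : ∀ c ∈ minCutValues A k α β, ∃ m : ℕ, c = m := by
    rintro _ ⟨h, D, rfl⟩
    obtain ⟨X, Y, -, hc⟩ := exists_minCut_eq_cutCost A α β h D
    exact ⟨_, hc.trans (cutCost_natCast A α β h X Y)⟩
  obtain ⟨D, -, hD⟩ := Finset.exists_subset_card_eq (s := (Finset.univ : Finset (Fin n)))
    (by simpa using hk)
  have hne : {m : ℕ | (m : ℝ≥0∞) ∈ minCutValues A k α β}.Nonempty := by
    have hmem : minCut (ifgCapacity A k α β []) .source (.collector ⟨D, hD⟩) ∈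
        minCutValues A k α β := ⟨[], ⟨D, hD⟩, rfl⟩
    obtain ⟨m, hm⟩ := hnat _ hmem
    exact ⟨m, by rw [Set.mem_ofPred_eq, ← hm]; exact hmem⟩
  refine ⟨_, Nat.sInf_mem hne, fun c hc => ?_⟩
  obtain ⟨m, rfl⟩ := hnat c hc
  exact Nat.cast_le.2 (Nat.sInf_le hc)

end Capacity

/-! ### The lower bound of blind repair and tight cuts -/

section LowerBound

/-- The number of elements of `X` that are born before `x`. -/
def rankIn {n T : ℕ} (X : Finset (StorageNode n T)) (x : StorageNode n T) : ℕ :=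
  (X.filter fun y => birth y < birth x).card

/-- Ranked by an injective key, the elements of a set of size `m` have the ranks `0, …, m - 1`. -/
theorem sum_rank {ι R : Type*} [DecidableEq ι] [AddCommMonoid R] (e : ι → ℕ)
    (he : Function.Injective e) (X : Finset ι) (φ : ℕ → R) :
    ∑ x ∈ X, φ (X.filter fun y => e y < e x).card = ∑ i ∈ Finset.range X.card, φ i := by
  induction X using Finset.induction_on_max_value e with
  | empty => simp
  | insert a X ha hmax ih =>
    have hlt : ∀ x ∈ X, e x < e a := fun x hx =>
      lt_of_le_of_ne (hmax x hx) fun h => ha (he h ▸ hx)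
    rw [Finset.sum_insert ha, Finset.card_insert_of_notMem ha, Finset.sum_range_succ, ← ih,
      add_comm]
    congr 1
    · refine Finset.sum_congr rfl fun x hx => ?_
      rw [Finset.filter_insert, if_neg (hlt x hx).not_gt]
    · rw [Finset.filter_insert, if_neg (lt_irrefl _), Finset.filter_true_of_mem hlt]

variable {n d : ℕ}

/-- The share of the storage node `x` in the value of the cut given by `X` and `Y`: either the edge
from its input to its output is cut, or all edges from its helpers outside `X`. -/
def nodeCost {R : Type*} [CommSemiring R] (A : HelperScheme n d) (α β : R) (h : List (Fin n))
    (X : Finset (StorageNode n h.length)) (Y : Finset (Fin h.length)) :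
    StorageNode n h.length → R
  | .inl _ => α
  | .inr s => if s ∈ Y then ((outerHelpers A h X s).card : R) * β else α

theorem sum_nodeCost_le {R : Type*} [CommSemiring R] [PartialOrder R] [IsOrderedRing R]
    [CanonicallyOrderedAdd R] (A : HelperScheme n d) (α β : R) (h : List (Fin n))
    (X : Finset (StorageNode n h.length)) (Y : Finset (Fin h.length)) :
    ∑ x ∈ X, nodeCost A α β h X Y x ≤ cutCost A α β h X Y := by
  rw [← Finset.sum_sdiff (Finset.inter_subset_left (s₁ := X)
    (s₂ := Y.map Function.Embedding.inr)), Finset.sdiff_inter_self_left, cutCost]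
  refine add_le_add (le_of_eq ?_) ?_
  · rw [← nsmul_eq_mul, ← Finset.sum_const]
    refine Finset.sum_congr rfl fun x hx => ?_
    rcases x with i | s
    · rfl
    · exact if_neg fun hs => by simp [hs] at hx
  · refine (Finset.sum_le_sum_of_subset Finset.inter_subset_right).trans (le_of_eq ?_)
    rw [Finset.sum_map]
    exact Finset.sum_congr rfl fun s hs => if_pos hs

theorem outerHelpers_card_add_card (A : HelperScheme n d) (h : List (Fin n))
    (X : Finset (StorageNode n h.length)) (s : Fin h.length) :
    ((A.helpers (h.take s) h[s]).filter fun i => activeNode h s i ∈ X).card +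
      (outerHelpers A h X s).card = d := by
  rw [outerHelpers, Finset.card_filter_add_card_filter_not, A.card_helpers]

theorem image_innerHelpers_subset (A : HelperScheme n d) (h : List (Fin n))
    (X : Finset (StorageNode n h.length)) (s : Fin h.length) :
    (((A.helpers (h.take s) h[s]).filter fun i => activeNode h s i ∈ X).image (activeNode h s)) ⊆
      X.filter fun y => birth y < birth (Sum.inr s : StorageNode n h.length) := by
  intro y hy
  simp only [Finset.mem_image, Finset.mem_filter] at hy ⊢
  obtain ⟨i, ⟨-, hi⟩, rfl⟩ := hy
  exact ⟨hi, birth_activeNode_lt h s i⟩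

theorem innerHelpers_card_le (A : HelperScheme n d) (h : List (Fin n))
    (X : Finset (StorageNode n h.length)) (s : Fin h.length) :
    ((A.helpers (h.take s) h[s]).filter fun i => activeNode h s i ∈ X).card ≤
      rankIn X (Sum.inr s) := by
  rw [← Finset.card_image_of_injective _ (activeNode_injective h s)]
  exact Finset.card_le_card (image_innerHelpers_subset A h X s)

theorem le_outerHelpers_card (A : HelperScheme n d) (h : List (Fin n))
    (X : Finset (StorageNode n h.length)) (s : Fin h.length) :
    d - rankIn X (Sum.inr s) ≤ (outerHelpers A h X s).card := by
  have h1 := outerHelpers_card_add_card A h X s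
  have h2 := innerHelpers_card_le A h X s
  omega

theorem card_le_of_active_mem {h : List (Fin n)} {X : Finset (StorageNode n h.length)}
    {D : Finset (Fin n)} (hX : ∀ i ∈ D, activeNode h h.length i ∈ X) : D.card ≤ X.card :=
  Finset.card_le_card_of_injOn _ hX (activeNode_injective h _).injOn

/-- Every cut is at least as expensive as under blind repair: the storage node of rank `i` in `X`
has at most `i` helpers in `X`. -/
theorem blindRepairValue_le_minCut (A : HelperScheme n d) {k : ℕ} (α β : ℝ≥0) (h : List (Fin n))
    (D : {D : Finset (Fin n) // D.card = k}) :
    blindRepairValue k d α β ≤ minCut (ifgCapacity A k α β h) .source (.collector D) := by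
  obtain ⟨X, Y, hX, hc⟩ := exists_minCut_eq_cutCost A α β h D
  rw [hc]
  refine le_trans ?_ (sum_nodeCost_le A (α : ℝ≥0∞) β h X Y)
  have hk : k ≤ X.card := D.2 ▸ card_le_of_active_mem hX
  have h1 : blindRepairValue k d α β ≤ ∑ x ∈ X, min (((d - rankIn X x : ℕ) : ℝ≥0∞) * β) α := by
    rw [blindRepairValue]
    refine (Finset.sum_le_sum_of_subset (Finset.range_subset_range.2 hk)).trans (le_of_eq ?_)
    exact (sum_rank birth birth_injective X fun i => min (((d - i : ℕ) : ℝ≥0∞) * β) α).symm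
  refine h1.trans (Finset.sum_le_sum fun x _ => ?_)
  rcases x with i | s
  · exact min_le_right _ _
  · simp only [nodeCost]
    split_ifs
    · refine (min_le_left _ _).trans ?_
      gcongr
      exact le_outerHelpers_card A h X s
    · exact min_le_right _ _

/-- With `α = d` and `β = 1`, a cut that is not more expensive than under blind repair is tight at
each of its storage nodes. -/
theorem nodeCost_eq_of_cutCost_le (A : HelperScheme n d) {k : ℕ} (h : List (Fin n))
    (X : Finset (StorageNode n h.length)) (Y : Finset (Fin h.length)) (hk : k ≤ X.card)
    (hcut : cutCost A d 1 h X Y ≤ ∑ i ∈ Finset.range k, (d - i)) :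
    ∀ x ∈ X, d - rankIn X x = nodeCost A d 1 h X Y x := by
  have hle : ∀ x ∈ X, d - rankIn X x ≤ nodeCost A d 1 h X Y x := by
    rintro (i | s) _
    · exact Nat.sub_le _ _
    · simp only [nodeCost, Nat.cast_id, mul_one]
      split_ifs
      · exact le_outerHelpers_card A h X s
      · exact Nat.sub_le _ _
  refine (Finset.sum_eq_sum_iff_of_le hle).1 ((Finset.sum_le_sum hle).antisymm ?_)
  refine ((sum_nodeCost_le A d 1 h X Y).trans hcut).trans ?_
  refine (Finset.sum_le_sum_of_subset (Finset.range_subset_range.2 hk)).trans (le_of_eq ?_)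
  exact (sum_rank birth birth_injective X fun i => d - i).symm

/-- In a tight cut, a storage node that is not the oldest one is a newcomer, and the number of its
helpers outside the cut is as small as possible. -/
theorem exists_inr_of_tight (A : HelperScheme n d) (h : List (Fin n))
    {X : Finset (StorageNode n h.length)} {Y : Finset (Fin h.length)} (hd : 1 ≤ d)
    (htight : ∀ x ∈ X, d - rankIn X x = nodeCost A d 1 h X Y x) {x : StorageNode n h.length}
    (hx : x ∈ X) (hrank : rankIn X x ≠ 0) :
    ∃ s, x = Sum.inr s ∧ (outerHelpers A h X s).card = d - rankIn X x := by
  have h1 := htight x hx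
  rcases x with i | s
  · simp only [nodeCost] at h1
    omega
  · simp only [nodeCost, Nat.cast_id, mul_one] at h1
    split_ifs at h1
    · exact ⟨s, rfl, h1.symm⟩
    · omega

/-- In a tight cut, each of the first `d + 1` storage nodes is helped by all older ones. -/
theorem older_mem_helpers_of_tight (A : HelperScheme n d) (h : List (Fin n))
    {X : Finset (StorageNode n h.length)} {Y : Finset (Fin h.length)} (hd : 1 ≤ d)
    (htight : ∀ x ∈ X, d - rankIn X x = nodeCost A d 1 h X Y x) {x y : StorageNode n h.length}
    (hx : x ∈ X) (hy : y ∈ X) (hrank : rankIn X x ≤ d) (hyx : birth y < birth x) :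
    ∃ s : Fin h.length, x = Sum.inr s ∧
      ∃ i ∈ A.helpers (h.take s) h[s], y = activeNode h s i := by
  have hmem : y ∈ X.filter fun y => birth y < birth x := Finset.mem_filter.2 ⟨hy, hyx⟩
  obtain ⟨s, rfl, hs⟩ := exists_inr_of_tight A h hd htight hx
    (Finset.card_pos.2 ⟨y, hmem⟩).ne'
  have h1 := outerHelpers_card_add_card A h X s
  have h2 := Finset.eq_of_subset_of_card_le (image_innerHelpers_subset A h X s) (by
    rw [Finset.card_image_of_injective _ (activeNode_injective h s)]
    change rankIn X (Sum.inr s) ≤ _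
    omega)
  rw [← h2] at hmem
  simp only [Finset.mem_image, Finset.mem_filter] at hmem
  obtain ⟨i, ⟨hi, -⟩, rfl⟩ := hmem
  exact ⟨s, rfl, i, hi, rfl⟩

/-- In a tight cut, a storage node that is not the oldest one has a helper in the cut. -/
theorem exists_helper_mem_of_tight (A : HelperScheme n d) (h : List (Fin n))
    {X : Finset (StorageNode n h.length)} {Y : Finset (Fin h.length)} (hd : 1 ≤ d)
    (htight : ∀ x ∈ X, d - rankIn X x = nodeCost A d 1 h X Y x) {x : StorageNode n h.length}
    (hx : x ∈ X) (hrank : rankIn X x ≠ 0) :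
    ∃ s : Fin h.length, x = Sum.inr s ∧
      ∃ i ∈ A.helpers (h.take s) h[s], activeNode h s i ∈ X := by
  obtain ⟨s, rfl, hs⟩ := exists_inr_of_tight A h hd htight hx hrank
  have h1 := outerHelpers_card_add_card A h X s
  obtain ⟨i, hi⟩ := Finset.card_pos.1 (show 0 <
    ((A.helpers (h.take s) h[s]).filter fun i => activeNode h s i ∈ X).card by omega)
  rw [Finset.mem_filter] at hi
  exact ⟨s, rfl, i, hi⟩

end LowerBound

/-! ### Schemes that beat blind repair -/

section Schemes

variable {n d : ℕ}

/-- If no node is helped by a node of its own part and there are fewer than `k` parts, at most `d`,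
then blind repair is beaten: in a tight cut, the first `d + 1` storage nodes would be in different
parts. -/
theorem lt_cutCost_of_parts (A : HelperScheme n d) {k P : ℕ} (p : Fin n → ℕ) (hp : ∀ i, p i < P)
    (hA : ∀ h j, ∀ i ∈ A.helpers h j, p i ≠ p j) (hd : 1 ≤ d) (hPk : P < k) (hPd : P ≤ d)
    (h : List (Fin n)) (X : Finset (StorageNode n h.length)) (Y : Finset (Fin h.length))
    (hk : k ≤ X.card) : ∑ i ∈ Finset.range k, (d - i) < cutCost A d 1 h X Y := by
  by_contra! hcut
  have htight := nodeCost_eq_of_cutCost_le A h X Y hk hcut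
  have hcard : P < (X.filter fun x => rankIn X x ≤ d).card := by
    have h1 := sum_rank birth birth_injective X fun i => if i ≤ d then 1 else 0
    rw [← Finset.sum_filter, ← Finset.sum_filter, ← Finset.card_eq_sum_ones,
      ← Finset.card_eq_sum_ones] at h1
    have h2 : Finset.range (P + 1) ⊆ (Finset.range X.card).filter fun i => i ≤ d := fun i hi => by
      simp only [Finset.mem_range, Finset.mem_filter] at hi ⊢
      omega
    have h3 := Finset.card_le_card h2
    rw [Finset.card_range, ← h1] at h3
    exact h3
  obtain ⟨x, hx, y, hy, hxy, hpxy⟩ := Finset.exists_ne_map_eq_of_card_lt_of_maps_to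
    (t := Finset.range P) (by rwa [Finset.card_range])
    (f := fun x => p (roleOf h x)) (fun x _ => by simpa using hp _)
  rw [Finset.mem_filter] at hx hy
  have key : ∀ x y, x ∈ X → y ∈ X → rankIn X x ≤ d → birth y < birth x →
      p (roleOf h y) ≠ p (roleOf h x) := by
    intro x y hx hy hr hyx
    obtain ⟨s, rfl, i, hi, rfl⟩ := older_mem_helpers_of_tight A h hd htight hx hy hr hyx
    rw [roleOf_activeNode]
    exact hA _ _ i hi
  rcases lt_trichotomy (birth x) (birth y) with hlt | heq | hlt
  · exact key y x hy.1 hx.1 hy.2 hlt hpxy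
  · exact hxy (birth_injective heq)
  · exact key x y hx.1 hy.1 hx.2 hlt hpxy.symm

/-- If every node is helped within its own component and all components have fewer than `k` nodes,
then blind repair is beaten: a tight cut would lie in a single component. -/
theorem lt_cutCost_of_components (A : HelperScheme n d) {k : ℕ} (p : Fin n → ℕ)
    (hA : ∀ h j, ∀ i ∈ A.helpers h j, p i = p j) (hd : 1 ≤ d)
    (hp : ∀ c, (Finset.univ.filter fun i => p i = c).card < k) (h : List (Fin n))
    (D : Finset (Fin n)) (hD : D.card = k) (X : Finset (StorageNode n h.length))
    (Y : Finset (Fin h.length)) (hX : ∀ i ∈ D, activeNode h h.length i ∈ X) :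
    ∑ i ∈ Finset.range k, (d - i) < cutCost A d 1 h X Y := by
  by_contra! hcut
  have htight := nodeCost_eq_of_cutCost_le A h X Y (hD ▸ card_le_of_active_mem hX) hcut
  obtain ⟨i₀, hi₀⟩ : D.Nonempty := by
    rw [← Finset.card_pos, hD]
    exact (Nat.zero_le _).trans_lt (hp 0)
  obtain ⟨x₀, hx₀, hmin⟩ := Finset.exists_min_image X birth ⟨_, hX i₀ hi₀⟩
  have hcomp : ∀ m, ∀ x ∈ X, birth x = m → p (roleOf h x) = p (roleOf h x₀) := by
    intro m
    induction m using Nat.strong_induction_on with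
    | _ m ih =>
      rintro x hx rfl
      by_cases hr : rankIn X x = 0
      · rw [rankIn, Finset.card_eq_zero] at hr
        have : ¬ birth x₀ < birth x := fun hlt => by
          have : x₀ ∈ X.filter fun y => birth y < birth x := Finset.mem_filter.2 ⟨hx₀, hlt⟩
          simp [hr] at this
        rw [birth_injective ((hmin x hx).antisymm (not_lt.1 this))]
      · obtain ⟨s, rfl, i, hi, hiX⟩ := exists_helper_mem_of_tight A h hd htight hx hr
        rw [← ih _ (birth_activeNode_lt h s i) _ hiX rfl, roleOf_activeNode]
        exact (hA _ _ i hi).symm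
  have hsub : D ⊆ Finset.univ.filter fun i => p i = p (roleOf h x₀) := fun i hi => by
    have := hcomp _ _ (hX i hi) rfl
    rw [roleOf_activeNode] at this
    simpa using this
  have := (Finset.card_le_card hsub).trans_lt (hp _)
  omega

/-- The stationary scheme in which the helpers of `j` are always `H j`. -/
def stationaryScheme (H : Fin n → Finset (Fin n)) (hH : ∀ j, (H j).card = d)
    (hj : ∀ j, j ∉ H j) : HelperScheme n d where
  helpers _ j := H j
  card_helpers _ := hH
  not_mem_helpers _ := hj

theorem exists_scheme_of_parts (hd : 1 ≤ d) (hdn : d < n) {k : ℕ} (hkn : k ≤ n)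
    (hd2 : d ≠ 1) (hk : n ≤ (k - 1) * (n - d)) :
    ∃ A : HelperScheme n d, ∀ (h : List (Fin n)) (D : Finset (Fin n)), D.card = k →
      ∀ (X : Finset (StorageNode n h.length)) (Y : Finset (Fin h.length)),
        (∀ i ∈ D, activeNode h h.length i ∈ X) →
        ∑ i ∈ Finset.range k, (d - i) < cutCost A d 1 h X Y := by
  -- Consecutive blocks of `n - d` nodes; each node is helped from outside its block.
  set r := n - d with hr
  have hr0 : 0 < r := by omega
  have hclass : ∀ c, (Finset.univ.filter fun i : Fin n => (i : ℕ) / r = c).card ≤ r := by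
    intro c
    refine (Finset.card_le_card_of_injOn (t := Finset.range r) (fun i : Fin n => (i : ℕ) % r)
      ?_ ?_).trans (Finset.card_range r).le
    · intro i _
      simpa using Nat.mod_lt _ hr0
    · intro i hi j hj hij
      simp only [Finset.coe_filter, Finset.mem_univ, true_and, Set.mem_ofPred_eq] at hi hj hij
      refine Fin.ext ?_
      rw [← Nat.div_add_mod (i : ℕ) r, ← Nat.div_add_mod (j : ℕ) r, hi, hj, hij]
  have hH : ∀ j : Fin n, ∃ H : Finset (Fin n),
      H ⊆ (Finset.univ.filter fun i : Fin n => ¬ (i : ℕ) / r = (j : ℕ) / r) ∧ H.card = d := by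
    intro j
    refine Finset.exists_subset_card_eq ?_
    have h1 := Finset.card_filter_add_card_filter_not
      (s := (Finset.univ : Finset (Fin n))) (fun i : Fin n => (i : ℕ) / r = (j : ℕ) / r)
    rw [Finset.card_univ, Fintype.card_fin] at h1
    have h2 := hclass ((j : ℕ) / r)
    omega
  choose H hHsub hHcard using hH
  have hne : ∀ j, ∀ i ∈ H j, (i : ℕ) / r ≠ (j : ℕ) / r := fun j i hi => by
    simpa using hHsub j hi
  let A := stationaryScheme H hHcard fun j hj => hne j j hj rfl
  -- There are at most `d` blocks. As `k ≤ n`, blocks of a single node are excluded by `hk`.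
  have hkd : n ≤ d * r := by
    have h1 : 2 ≤ r := by
      by_contra hcon
      obtain h1 : r = 1 := by omega
      rw [h1] at hk
      omega
    obtain ⟨e, rfl⟩ : ∃ e, d = e + 2 := ⟨d - 2, by omega⟩
    obtain ⟨f, hf⟩ : ∃ f, r = f + 2 := ⟨r - 2, by omega⟩
    have : n = e + 2 + (f + 2) := by omega
    rw [hf, this]
    nlinarith
  refine ⟨A, fun h D hD X Y hX => ?_⟩
  refine lt_cutCost_of_parts A (k := k) (P := min (k - 1) d) (fun i => (i : ℕ) / r) ?_
    (fun h j i hi => hne j i hi) hd ?_ (min_le_right _ _) h X Y (hD ▸ card_le_of_active_mem hX)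
  · intro i
    refine lt_min ?_ ?_ <;> rw [Nat.div_lt_iff_lt_mul hr0]
    · exact i.2.trans_le hk
    · exact i.2.trans_le hkd
  · have : k ≠ 0 := by
      rintro rfl
      simp at hk
      omega
    exact (min_le_left _ _).trans_lt (by omega)

theorem exists_scheme_of_components {k : ℕ} (hkn : k ≤ n) (hk : 3 ≤ k)
    (hodd : ¬ (k = 3 ∧ Odd n)) :
    ∃ A : HelperScheme n 1, ∀ (h : List (Fin n)) (D : Finset (Fin n)), D.card = k →
      ∀ (X : Finset (StorageNode n h.length)) (Y : Finset (Fin h.length)),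
        (∀ i ∈ D, activeNode h h.length i ∈ X) →
        ∑ i ∈ Finset.range k, (1 - i) < cutCost A 1 1 h X Y := by
  -- Pairs of consecutive nodes; if `n` is odd, the last node joins the last pair.
  let p : Fin n → ℕ := fun i => min ((i : ℕ) / 2) (n / 2 - 1)
  have hpartner : ∀ j : Fin n, ∃ i : Fin n, i ≠ j ∧ p i = p j := by
    intro j
    have hj := j.2
    by_cases h1 : (j : ℕ) % 2 = 0 ∧ (j : ℕ) + 1 < n
    · refine ⟨⟨j + 1, h1.2⟩, by simp [Fin.ext_iff], ?_⟩
      simp only [p]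
      omega
    · refine ⟨⟨j - 1, by omega⟩, ?_, ?_⟩
      · rw [ne_eq, Fin.ext_iff]
        dsimp only
        omega
      · simp only [p]
        omega
  choose f hfne hfp using hpartner
  let A : HelperScheme n 1 := stationaryScheme (fun j => {f j}) (fun j => by simp)
    fun j => by simpa using (hfne j).symm
  refine ⟨A, fun h D hD X Y hX => ?_⟩
  have := lt_cutCost_of_components A p (k := k) ?_ le_rfl ?_ h D hD X Y hX
  · simpa using this
  · intro h j i hi
    obtain rfl : i = f j := by simpa [A, stationaryScheme] using hi
    exact hfp j
  · intro c
    have h1 : ((Finset.univ.filter fun i => p i = c).map Fin.valEmbedding) ⊆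
        if Odd n then {2 * c, 2 * c + 1, 2 * c + 2} else {2 * c, 2 * c + 1} := by
      intro x hx
      simp only [Finset.mem_map, Finset.mem_filter, Finset.mem_univ, true_and,
        Fin.valEmbedding_apply, p] at hx
      obtain ⟨i, hi, rfl⟩ := hx
      have := i.2
      split_ifs with ho
      · rw [Nat.odd_iff] at ho
        simp only [Finset.mem_insert, Finset.mem_singleton]
        omega
      · rw [Nat.odd_iff] at ho
        simp only [Finset.mem_insert, Finset.mem_singleton]
        omega
    have h2 := Finset.card_le_card h1
    rw [Finset.card_map] at h2
    split_ifs at h2 with ho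
    · have := h2.trans Finset.card_le_three
      have : k ≠ 3 := fun h => hodd ⟨h, ho⟩
      omega
    · have := h2.trans Finset.card_le_two
      omega

end Schemes

/-! ### Cliques of newcomers -/

section UpperBound

variable {n d : ℕ}

/-- A cut through newcomers only: each of them is separated in the cheaper way. -/
theorem minCut_le_sum_min (A : HelperScheme n d) {k : ℕ} (α β : ℝ≥0) (h : List (Fin n))
    (D : {D : Finset (Fin n) // D.card = k}) (S : Finset (Fin h.length))
    (hS : ∀ i ∈ D.1, activeNode h h.length i ∈ S.map Function.Embedding.inr) :
    minCut (ifgCapacity A k α β h) .source (.collector D) ≤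
      ∑ s ∈ S, min (((outerHelpers A h (S.map Function.Embedding.inr) s).card : ℝ≥0∞) * β) α := by
  classical
  refine (minCut_le_cutCost A α β h D _ (S.filter fun s =>
    ((outerHelpers A h (S.map Function.Embedding.inr) s).card : ℝ≥0∞) * β ≤ α) hS).trans ?_
  rw [cutCost, ← Finset.map_sdiff, Finset.card_map, ← Finset.filter_not, ← nsmul_eq_mul,
    ← Finset.sum_const, ← Finset.sum_filter_add_sum_filter_not S fun s =>
    ((outerHelpers A h (S.map Function.Embedding.inr) s).card : ℝ≥0∞) * β ≤ α, add_comm]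
  refine add_le_add (Finset.sum_le_sum fun s hs => ?_) (Finset.sum_le_sum fun s hs => ?_)
  · exact le_min le_rfl (Finset.mem_filter.1 hs).2
  · exact le_min (not_le.1 (Finset.mem_filter.1 hs).2).le le_rfl

/-- If the nodes `0, …, n - 1` fail first, in this order, then each failure replaces an initial
node. -/
theorem activeNode_of_failures_in_order {h : List (Fin n)} (hlen : n ≤ h.length)
    (hh : ∀ s (hs : s < n), h[s] = ⟨s, hs⟩) :
    ∀ s, s ≤ n → ∀ i : Fin n, activeNode h s i =
      if (i : ℕ) < s then Sum.inr ⟨i, i.2.trans_le hlen⟩ else Sum.inl i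
  | 0, _, i => by simp [activeNode]
  | s + 1, hs, i => by
    rw [activeNode, dif_pos (by omega), hh s (by omega),
      activeNode_of_failures_in_order hlen hh s (by omega) i]
    by_cases hi : (i : ℕ) = s
    · subst hi
      simp
    · rw [if_neg fun hc => hi (by rw [← hc])]
      congr 1
      exact propext (by omega)

/-- Let `H j` consist of `d` of the nodes other than `j`. Then a set of more than `(k - 1) (n - d)`
nodes contains `k` nodes each of which has all smaller ones among its helpers: choose the nodes
greedily, the largest first; each choice excludes at most `n - d - 1` others. -/
theorem exists_clique (H : Fin n → Finset (Fin n)) (hH : ∀ j, (H j).card = d)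
    (hj : ∀ j, j ∉ H j) (k : ℕ) :
    ∀ U : Finset (Fin n), k * (n - d) < U.card + (n - d) →
      ∃ C ⊆ U, C.card = k ∧ ∀ j ∈ C, ∀ i ∈ C, i < j → i ∈ H j := by
  induction k with
  | zero => exact fun U _ => ⟨∅, by simp, by simp, by simp⟩
  | succ k ih =>
    intro U hU
    rw [add_mul, one_mul] at hU
    obtain ⟨j, hjU, hmax⟩ := Finset.exists_max_image U id (Finset.card_pos.1 (by omega))
    obtain ⟨C, hCU, hCk, hC⟩ := ih (U.filter fun i => i ∈ H j) (by
      have h1 := Finset.card_filter_add_card_filter_not (s := U) (fun i => i ∈ H j)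
      have h2 : (U.filter fun i => i ∉ H j).card ≤ (Finset.univ \ H j).card :=
        Finset.card_le_card fun i hi => by simpa using (Finset.mem_filter.1 hi).2
      rw [Finset.card_sdiff_of_subset (Finset.subset_univ _), hH, Finset.card_univ,
        Fintype.card_fin] at h2
      omega)
    have hjC : j ∉ C := fun h => hj j (Finset.mem_filter.1 (hCU h)).2
    refine ⟨insert j C, ?_, by rw [Finset.card_insert_of_notMem hjC, hCk], ?_⟩
    · exact Finset.insert_subset hjU (hCU.trans (Finset.filter_subset _ _))
    · intro a ha b hb hba
      rcases Finset.mem_insert.1 ha with rfl | haC <;>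
        rcases Finset.mem_insert.1 hb with rfl | hbC
      · exact absurd hba (lt_irrefl _)
      · exact (Finset.mem_filter.1 (hCU hbC)).2
      · exact absurd hba (not_lt.2 (hmax a (Finset.filter_subset _ _ (hCU haC))))
      · exact hC a haC b hbC hba

/-- Blind repair is optimal if `k ≤ ⌈n / (n - d)⌉`: after each node has failed once, some `k` of
the newcomers are helped by all older ones among them. -/
theorem exists_minCut_le_of_clique (A : HelperScheme n d) {k : ℕ} (hk : 1 ≤ k)
    (hkn : (k - 1) * (n - d) < n) (α β : ℝ≥0) :
    ∃ (h : List (Fin n)) (D : {D : Finset (Fin n) // D.card = k}),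
      minCut (ifgCapacity A k α β h) .source (.collector D) ≤ blindRepairValue k d α β := by
  set h := List.finRange n with hdef
  have hlen : h.length = n := List.length_finRange
  have hh : ∀ s (hs : s < n), h[s] = ⟨s, hs⟩ := fun s hs => by simp [hdef]
  have hact := activeNode_of_failures_in_order hlen.ge hh
  obtain ⟨C, -, hCk, hC⟩ := exists_clique (fun j : Fin n => A.helpers (h.take j) j)
    (fun j => A.card_helpers _ _) (fun j => A.not_mem_helpers _ _) k Finset.univ (by
      obtain ⟨l, rfl⟩ : ∃ l, k = l + 1 := ⟨k - 1, by omega⟩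
      rw [Finset.card_univ, Fintype.card_fin, add_mul]
      simp only [add_tsub_cancel_right] at hkn
      omega)
  let e : Fin n ↪ Fin h.length := (finCongr hlen.symm).toEmbedding
  have he : ∀ i, e i = ⟨i, i.2.trans_le hlen.ge⟩ := fun i => rfl
  refine ⟨h, ⟨C, hCk⟩, (minCut_le_sum_min A α β h ⟨C, hCk⟩ (C.map e) ?_).trans ?_⟩
  · intro i hi
    rw [hact _ hlen.le, if_pos (by rw [hlen]; exact i.2)]
    exact Finset.mem_map_of_mem _ (Finset.mem_map_of_mem e hi)
  rw [Finset.sum_map, blindRepairValue, ← hCk,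
    ← sum_rank Fin.val Fin.val_injective C fun i => min (((d - i : ℕ) : ℝ≥0∞) * β) α]
  refine Finset.sum_le_sum fun j hj => ?_
  gcongr
  have h1 := outerHelpers_card_add_card A h ((C.map e).map Function.Embedding.inr) (e j)
  have h2 : (C.filter fun i : Fin n => (i : ℕ) < j) ⊆
      (A.helpers (h.take (e j)) h[e j]).filter fun i =>
        activeNode h (e j) i ∈ (C.map e).map Function.Embedding.inr := by
    intro i hi
    rw [Finset.mem_filter] at hi ⊢
    constructor
    · have h3 : h[e j] = j := hh j j.2
      rw [h3]
      exact hC j hj i hi.1 hi.2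
    · have h3 : ((e j : Fin h.length) : ℕ) = j := rfl
      rw [h3, hact j j.2.le, if_pos hi.2]
      exact Finset.mem_map_of_mem _ (Finset.mem_map_of_mem e hi.1)
  have h3 := Finset.card_le_card h2
  omega

end UpperBound

/-! ### Three nodes that descend from one newcomer -/

section Labels

variable {n : ℕ}

/-- The labels of the nodes when, at first, the labels are distinct and the newcomer that replaces a
failed node takes over the label of its only helper `hp g j`. The head of the list is the most
recent failure. -/
def labels (hp : List (Fin n) → Fin n → Fin n) : List (Fin n) → Fin n → Fin n
  | [] => id
  | j :: g => Function.update (labels hp g) j (labels hp g (hp g j))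

/-- For odd `n`, the failures can be chosen so that three nodes get the same label: let a node whose
label is unique fail, as often as necessary. The number of labels decreases, and by parity there is
such a node as long as no label occurs three times. -/
theorem exists_three_labels (hn : Odd n) (hp : List (Fin n) → Fin n → Fin n)
    (hne : ∀ g j, hp g j ≠ j) :
    ∃ g r, 3 ≤ (Finset.univ.filter fun i => labels hp g i = r).card := by
  by_contra! hcon
  suffices key : ∀ m g, (Finset.univ.image (labels hp g)).card ≤ m → False from key _ [] le_rfl
  intro m
  induction m with
  | zero =>
    intro g hg
    have : (⟨0, hn.pos⟩ : Fin n) ∈ (Finset.univ : Finset (Fin n)) := Finset.mem_univ _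
    have := Finset.card_pos.2 ⟨_, Finset.mem_image_of_mem (labels hp g) this⟩
    omega
  | succ m ih =>
    intro g hg
    have hsingle : ∃ r, (Finset.univ.filter fun i => labels hp g i = r).card = 1 := by
      by_contra! hno
      have h1 := Finset.card_eq_sum_card_image (labels hp g) Finset.univ
      rw [Finset.sum_congr rfl (g := fun _ => 2), Finset.sum_const, Finset.card_univ,
        Fintype.card_fin, smul_eq_mul] at h1
      · rw [Nat.odd_iff] at hn
        omega
      · intro r hr
        obtain ⟨i, -, hi⟩ := Finset.mem_image.1 hr
        have h2 : 0 < (Finset.univ.filter fun i => labels hp g i = r).card :=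
          Finset.card_pos.2 ⟨i, by simpa using hi⟩
        have h3 := hcon g r
        have h4 := hno r
        omega
    obtain ⟨r, hr⟩ := hsingle
    obtain ⟨j, hj⟩ := Finset.card_eq_one.1 hr
    have hj' : ∀ i, labels hp g i = r ↔ i = j := fun i => by
      simpa using Finset.ext_iff.1 hj i
    refine ih (j :: g) ?_
    have hsub : Finset.univ.image (labels hp (j :: g)) ⊆
        (Finset.univ.image (labels hp g)).erase r := by
      intro l hl
      obtain ⟨i, -, rfl⟩ := Finset.mem_image.1 hl
      rw [Finset.mem_erase]
      by_cases hi : i = j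
      · subst hi
        simp only [labels, Function.update_self]
        exact ⟨fun h => hne g i ((hj' _).1 h), Finset.mem_image_of_mem _ (Finset.mem_univ _)⟩
      · simp only [labels, Function.update_of_ne hi]
        exact ⟨fun h => hi ((hj' _).1 h), Finset.mem_image_of_mem _ (Finset.mem_univ _)⟩
    have h1 := Finset.card_le_card hsub
    rw [Finset.card_erase_of_mem (Finset.mem_image.2 ⟨j, Finset.mem_univ _, (hj' j).2 rfl⟩)] at h1
    omega

/-- Blind repair is optimal if `d = 1`, `k = 3` and `n` is odd: after each node has failed once,
further failures produce three nodes that descend from a single newcomer. -/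
theorem exists_minCut_le_of_odd (A : HelperScheme n 1) (hn : Odd n) (α β : ℝ≥0) :
    ∃ (h : List (Fin n)) (D : {D : Finset (Fin n) // D.card = 3}),
      minCut (ifgCapacity A 3 α β h) .source (.collector D) ≤ blindRepairValue 3 1 α β := by
  choose q hq using fun (h : List (Fin n)) (j : Fin n) => Finset.card_eq_one.1 (A.card_helpers h j)
  have hqne : ∀ h j, q h j ≠ j := fun h j hc => A.not_mem_helpers h j (by rw [hq]; simp [hc])
  let hp : List (Fin n) → Fin n → Fin n := fun g j => q (List.finRange n ++ g.reverse) j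
  obtain ⟨g, r, hr⟩ := exists_three_labels hn hp fun g j => hqne _ _
  obtain ⟨D, hDr, hD⟩ := Finset.exists_subset_card_eq hr
  set h := List.finRange n ++ g.reverse with hdef
  have hlen : h.length = n + g.length := by simp [hdef]
  have hh : ∀ s (hs : s < n), h[s] = ⟨s, hs⟩ := fun s hs => by
    simp only [hdef]
    rw [List.getElem_append_left (by simpa using hs)]
    simp
  have hact := activeNode_of_failures_in_order (by omega) hh
  -- The labels of the nodes at time `s`.
  let lab : ℕ → Fin n → Fin n := fun s => labels hp (g.reverse.take (s - n)).reverse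
  have lab_le : ∀ s ≤ n, lab s = id := fun s hs => by
    simp [lab, Nat.sub_eq_zero_of_le hs, labels]
  have lab_length : lab h.length = labels hp g := by
    simp only [lab]
    rw [List.take_of_length_le (by simp [hlen]), List.reverse_reverse]
  have lab_succ : ∀ s (hs : s < h.length), n ≤ s →
      lab (s + 1) = Function.update (lab s) h[s] (lab s (q (h.take s) h[s])) := by
    intro s hs hns
    have hs' : s - n < g.reverse.length := by simp; omega
    have h1 : h[s] = g.reverse[s - n] := by
      simp only [hdef]
      rw [List.getElem_append_right (by simpa using hns)]
      simp
    have h2 : h.take s = List.finRange n ++ g.reverse.take (s - n) := by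
      rw [hdef, List.take_append, List.take_of_length_le (by simpa using hns)]
      simp
    simp only [lab]
    rw [show s + 1 - n = s - n + 1 by omega, List.take_add_one, List.getElem?_eq_getElem hs']
    simp only [Option.toList_some, List.reverse_append, List.reverse_singleton,
      List.singleton_append, labels, hp, List.reverse_reverse]
    rw [h1, h2]
  -- The label of a newcomer is the one that its node has right after the repair.
  let nu : Fin h.length → Fin n := fun t => lab (t + 1) h[t]
  have hactive : ∀ s, n ≤ s → s ≤ h.length →
      ∀ i, ∃ t, activeNode h s i = Sum.inr t ∧ nu t = lab s i := by
    intro s hns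
    induction s, hns using Nat.le_induction with
    | base =>
      intro _ i
      refine ⟨⟨i, by omega⟩, by rw [hact n le_rfl, if_pos i.2], ?_⟩
      simp only [nu]
      rw [lab_le _ i.2, lab_le _ le_rfl]
      exact hh i i.2
    | succ s hns ih =>
      intro hs i
      have hs' : s < h.length := hs
      rw [activeNode, dif_pos hs']
      by_cases hi : h[s] = i
      · rw [if_pos hi]
        exact ⟨⟨s, hs'⟩, rfl, by simp only [nu]; rw [← hi]; rfl⟩
      · rw [if_neg hi, lab_succ s hs' hns, Function.update_of_ne (Ne.symm hi)]
        exact ih hs'.le i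
  refine ⟨h, ⟨D, hD⟩, (minCut_le_sum_min A α β h ⟨D, hD⟩
    (Finset.univ.filter fun t => nu t = r) ?_).trans ?_⟩
  · intro i hi
    obtain ⟨t, ht, htl⟩ := hactive h.length (by omega) le_rfl i
    rw [ht]
    refine Finset.mem_map_of_mem Function.Embedding.inr ?_
    rw [lab_length] at htl
    have := hDr hi
    simpa [htl] using this
  set S := Finset.univ.filter fun t => nu t = r with hS
  have hzero : ∀ t ∈ S, (t : ℕ) ≠ r →
      min (((outerHelpers A h (S.map Function.Embedding.inr) t).card : ℝ≥0∞) * β) α = 0 := by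
    intro t ht htr
    have htS : nu t = r := by simpa [hS] using ht
    have hnt : n ≤ t := by
      by_contra hlt
      refine htr ?_
      rw [← htS]
      simp only [nu]
      rw [lab_le _ (by omega)]
      exact (congrArg Fin.val (hh t (by omega))).symm
    have hempty : outerHelpers A h (S.map Function.Embedding.inr) t = ∅ := by
      rw [Finset.eq_empty_iff_forall_notMem]
      intro i hi
      simp only [outerHelpers, hq, Finset.mem_filter, Finset.mem_singleton] at hi
      obtain ⟨u, hu, hul⟩ := hactive t hnt t.2.le i
      refine hi.2 (hu ▸ Finset.mem_map_of_mem Function.Embedding.inr ?_)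
      have h1 : nu t = lab t i := by
        simp only [nu]
        rw [lab_succ t t.2 hnt, hi.1]
        exact Function.update_self _ _ _
      simp [hS, hul, ← h1, htS]
    simp [hempty]
  have hrlt : (r : ℕ) < h.length := by omega
  have hvalue : min (((1 : ℕ) : ℝ≥0∞) * β) α ≤ blindRepairValue 3 1 α β := by
    rw [blindRepairValue]
    exact Finset.single_le_sum (f := fun i => min (((1 - i : ℕ) : ℝ≥0∞) * β) (α : ℝ≥0∞))
      (fun _ _ => zero_le) (Finset.mem_range.2 (by norm_num : 0 < 3))
  refine le_trans ?_ hvalue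
  refine (Finset.sum_le_sum_of_ne_zero (t := {⟨r, hrlt⟩}) ?_).trans ?_
  · intro t ht h0
    by_contra hne
    exact h0 (hzero t ht fun hc => hne (Finset.mem_singleton.2 (Fin.ext hc)))
  · rw [Finset.sum_singleton]
    gcongr
    exact (Finset.card_filter_le _ _).trans (A.card_helpers _ _).le

end Labels

/-! ### The dichotomy -/

/-- The threshold in the statement, without division. -/
theorem le_ceil_iff {n k d : ℕ} (hk : 1 ≤ k) (hdn : d < n) :
    k ≤ ⌈(n : ℚ) / ((n : ℚ) - (d : ℚ))⌉₊ ↔ (k - 1) * (n - d) < n := by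
  have h1 : (0 : ℚ) < (n : ℚ) - d := by
    rw [sub_pos]
    exact_mod_cast hdn
  obtain ⟨l, rfl⟩ : ∃ l, k = l + 1 := ⟨k - 1, by omega⟩
  rw [Nat.add_one_le_iff, Nat.lt_ceil, lt_div_iff₀ h1, ← Nat.cast_sub hdn.le, ← Nat.cast_mul,
    Nat.cast_lt, add_tsub_cancel_right]

theorem blindRepairValue_natCast (k d : ℕ) :
    blindRepairValue k d (d : ℕ) (1 : ℕ) = (∑ i ∈ Finset.range k, (d - i) : ℕ) := by
  rw [blindRepairValue, Nat.cast_sum]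
  refine Finset.sum_congr rfl fun i _ => ?_
  rw [Nat.cast_one, ENNReal.coe_one, mul_one, ENNReal.coe_natCast, min_eq_left]
  exact Nat.cast_le.2 (Nat.sub_le _ _)

theorem proposition1 (n k d : ℕ) (hn : 2 ≤ n) (hk : 1 ≤ k) (hkn : k ≤ n) (hd : 1 ≤ d)
    (hdn : d ≤ n - 1) :
    (((d = 1 ∧ k = 3 ∧ Odd n) ∨ k ≤ ⌈(n : ℚ) / ((n : ℚ) - (d : ℚ))⌉₊) →
      ∀ (A : HelperScheme n d) (α β : ℝ≥0),
        IsLeast (minCutValues A k α β) (blindRepairValue k d α β)) ∧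
    (¬ ((d = 1 ∧ k = 3 ∧ Odd n) ∨ k ≤ ⌈(n : ℚ) / ((n : ℚ) - (d : ℚ))⌉₊) →
      ∃ (A : HelperScheme n d) (α β : ℕ) (c : ℝ≥0∞),
        IsLeast (minCutValues A k α β) c ∧
        blindRepairValue k d α β < c ∧
        ∀ M : ℕ, (M : ℝ≥0∞) ≤ c →
          ∃ (F : Type) (_ : Field F) (_ : Finite F) (C : RegeneratingCode F A M α β),
            C.Reliable k) := by
  have hdn' : d < n := by omega
  rw [le_ceil_iff hk hdn']
  constructor
  · intro hcond A α β
    have hlower : blindRepairValue k d α β ∈ lowerBounds (minCutValues A k α β) := by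
      rintro _ ⟨h, D, rfl⟩
      exact blindRepairValue_le_minCut A α β h D
    obtain ⟨h, D, hle⟩ : ∃ (h : List (Fin n)) (D : {D : Finset (Fin n) // D.card = k}),
        minCut (ifgCapacity A k α β h) .source (.collector D) ≤ blindRepairValue k d α β := by
      rcases hcond with ⟨rfl, rfl, hodd⟩ | hlt
      · exact exists_minCut_le_of_odd A hodd α β
      · exact exists_minCut_le_of_clique A hk hlt α β
    exact ⟨⟨h, D, (blindRepairValue_le_minCut A α β h D).antisymm hle⟩, hlower⟩
  · intro hcond
    push Not at hcond
    obtain ⟨A, hA⟩ : ∃ A : HelperScheme n d, ∀ (h : List (Fin n)) (D : Finset (Fin n)),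
        D.card = k → ∀ (X : Finset (StorageNode n h.length)) (Y : Finset (Fin h.length)),
          (∀ i ∈ D, activeNode h h.length i ∈ X) →
          ∑ i ∈ Finset.range k, (d - i) < cutCost A d 1 h X Y := by
      by_cases hd1 : d = 1
      · subst hd1
        refine exists_scheme_of_components hkn ?_ fun hc => hcond.1 rfl hc.1 hc.2
        by_contra hlt
        have h1 : (k - 1) * (n - 1) ≤ 1 * (n - 1) := Nat.mul_le_mul_right _ (by omega)
        have := hcond.2
        omega
      · exact exists_scheme_of_parts hd hdn' hkn hd1 hcond.2
    obtain ⟨c, hc⟩ := exists_isLeast_minCutValues A hkn d 1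
    refine ⟨A, d, 1, c, hc, ?_, fun M hM =>
      exists_reliable_code_of_le_minCut A k d 1 M fun c' hc' => hM.trans (hc.2 hc')⟩
    obtain ⟨h, D, rfl⟩ := hc.1
    obtain ⟨X, Y, hX, hcut⟩ := exists_minCut_eq_cutCost A (d : ℕ) (1 : ℕ) h D
    rw [hcut, cutCost_natCast, blindRepairValue_natCast, Nat.cast_lt]
    exact hA h D.1 D.2 X Y hX
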